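/- Let $G=(V,E,w)$ be a finite weighted hypergraph with non-empty hyperedges and weights $w(e)\ge 0$, and suppose that every degree $d(v)=\sum_{e\in E,\,v\in e}w(e)$ is positive; put $D=\mathrm{diag}(d(v))$. For $e\in E$ let $B_e=\mathrm{conv}\{\mathbf 1_u-\mathbf 1_v : u,v\in e\}\subset\mathbb R^V$, and define the (multivalued) Laplacian and normalized Laplacian by $$L_G(x)=\Big\{\sum_{e\in E}w(e)\,b_e b_e^{\top}x \;:\; b_e\in\operatorname*{argmax}_{b\in B_e}b^{\top}x\Big\},\qquad \mathcal L_G(\rho)=L_G(D^{-1}\rho).$$ Let $s\in\mathbb R^V$ and let $(\rho_t)_{t\ge 0}$ be the solution of the heat equation $\frac{d\rho_t}{dt}\in-\mathcal L_G(\rho_t)$, $\rho_0=s$. Here and below, a solution on an interval is a function that is absolutely continuous on its compact subintervals, has the given initial value, and satisfies the equation at almost every time. Put $\mu_t=D^{-1}\rho_t$. For $t\ge0$ and $v\in V$ let $\mu_t^{(k)}(v)$, $k\ge 0$, be the right derivatives of $\mu(v)$ at $t$ (with $\mu_t^{(0)}=\mu_t$). Write $u\sim_t v$ if $\mu_t^{(k)}(u)=\mu_t^{(k)}(v)$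 for all $k\ge0$, and $u\succ_t v$ if there is $l\ge 0$ with $\mu_t^{(k)}(u)=\mu_t^{(k)}(v)$ for all $k<l$ and $\mu_t^{(l)}(u)>\mu_t^{(l)}(v)$; write $u\succeq_t v$ if $u\succ_t v$ or $u\sim_t v$. For $e\in E$ let $S_e^{t}$ be the set of those $u\in \operatorname{argmax}_{e}\mu_t$ with $u\succeq_t v$ for all $v\in\operatorname{argmax}_e\mu_t$, and let $I_e^{t}$ be the set of those $u\in\operatorname{argmin}_e\mu_t$ with $v\succeq_t u$ for all $v\in\operatorname{argmin}_e\mu_t$. Say that no tie occurs before $T$ if $S_e^{t}=S_e^{0}$ and $I_e^{t}=I_e^{0}$ for all $e\in E$ and $t\in[0,T)$. Let $U_1,\dots,U_m$ be the equivalence classes of $\sim_0$. Let $\widetilde G$ be the weighted undirected graph on $\{1,\dots,m\}$ with weights $$\widetilde w(kl)=\sum_{\substack{e\in E:\ S_e^0\cap U_k\ne\emptyset,\\ I_e^0\cap U_l\neq\emptyset}}w(e)+\sum_{\substack{e\in E:\ S_e^0\cap U_l\ne\emptyset,\\ I_e^0\cap U_k\neq\emptyset}}w(e)\quad(k\ne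 l),\qquad \widetilde w(kk)=\sum_{v\in U_k}d(v)-\sum_{l\ne k}\widetilde w(kl).$$ These weights are non-negative, and the degrees are $d_{\widetilde G}(k)=\sum_l\widetilde w(kl)=\sum_{v\in U_k}d(v)$ (a loop counts once). Let $\mathcal L_{\widetilde G}=I-A_{\widetilde G}D_{\widetilde G}^{-1}$, where $A_{\widetilde G}=(\widetilde w(kl))_{k,l}$ and $D_{\widetilde G}=\mathrm{diag}(d_{\widetilde G}(k))$, and put $\widetilde\rho_t=\big(\sum_{u\in U_k}\rho_t(u)\big)_k$ and $\widetilde s=\big(\sum_{u\in U_k}s(u)\big)_k$. **Theorem.** All right derivatives $\mu_t^{(k)}(v)$ exist ($t\ge 0$, $v\in V$, $k\ge 0$), and there is $T>0$ such that no tie occurs before $T$. For every $T>0$ such that no tie occurs before $T$: 1. On $[0,T)$, $\widetilde\rho_t$ is the unique solution of the linear heat equation $\frac{d\widetilde\rho_t}{dt}=-\mathcal L_{\widetilde G}\,\widetilde\rho_t$, $\widetilde\rho_0=\widetilde s$, and it satisfies this equation at every $t\in[0,T)$ (with the one-sided derivative at $t=0$). 2. On $[0,T)$, $\widetilde\rho_t$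 determines $\rho_t$: for every $k$ and every $u\in U_k$, $\rho_t(u)=d(u)\,\widetilde\rho_t(k)/d_{\widetilde G}(k)$. -/

import Mathlib

/-- A finite hypergraph on the vertex set `V` with nonempty hyperedges and nonnegative weights. -/
structure WeightedHypergraph (V : Type*) where
  edges : Finset (Finset V)
  weight : Finset V → ℝ
  edge_nonempty : ∀ e ∈ edges, e.Nonempty
  weight_nonneg : ∀ e ∈ edges, 0 ≤ weight e

/-- A finite weighted undirected graph (self-loops allowed): a symmetric nonnegative weight. -/
structure WeightedGraph (W : Type*) where
  weight : W → W → ℝ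
  weight_symm : ∀ a b, weight a b = weight b a
  weight_nonneg : ∀ a b, 0 ≤ weight a b

namespace WeightedGraph

variable {W : Type*} [Fintype W] [DecidableEq W]

/-- Weighted degree; a self-loop counts once. -/
def degree (H : WeightedGraph W) (a : W) : ℝ := ∑ b, H.weight a b

/-- The random-walk normalized Laplacian `I - A D⁻¹` of a weighted graph. -/
noncomputable def normalizedLaplacian (H : WeightedGraph W) : Matrix W W ℝ :=
  1 - Matrix.of H.weight * Matrix.diagonal (fun a => (H.degree a)⁻¹)

end WeightedGraph

/-- `ρ` is a solution on the set of times `I` (an interval starting at `0`) of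
`dρ/dt ∈ -A (ρ t)`, `ρ 0 = s`: it is absolutely continuous on the compact subintervals of `I`
and satisfies the inclusion at almost every time of `I`. -/
def IsHeatSolution {X : Type*} [Fintype X] (A : (X → ℝ) → Set (X → ℝ)) (s : X → ℝ)
    (I : Set ℝ) (ρ : ℝ → X → ℝ) : Prop :=
  (∀ a ∈ I, ∀ b ∈ I, AbsolutelyContinuousOnInterval ρ a b) ∧
  ρ 0 = s ∧
  ∀ᵐ t ∂(MeasureTheory.volume.restrict I), ∃ y ∈ A (ρ t), HasDerivAt ρ (-y) t

/-- The right derivative of a real function, as a function of the time. -/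
noncomputable def rightDeriv (f : ℝ → ℝ) (t : ℝ) : ℝ := derivWithin f (Set.Ici t) t

section OrderedEquivalence

/- In this section `κ v k` stands for the `k`-th right derivative at a fixed time of a
time-dependent vector at the vertex `v`; in particular `κ v 0` is the value of the vector. -/

variable {V : Type*}

/-- `u ≻ v`: the first derivative in which `u` and `v` differ is larger at `u`. -/
def LexAbove (κ : V → ℕ → ℝ) (u v : V) : Prop :=
  ∃ l, (∀ k < l, κ u k = κ v k) ∧ κ v l < κ u l

/-- `[u] ⪰ [v]`. -/
def LexAboveEq (κ : V → ℕ → ℝ) (u v : V) : Prop :=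
  κ u = κ v ∨ LexAbove κ u v

/-- The set of equivalence classes of `u ∼ v ↔ ∀ k, κ u k = κ v k`. -/
def DerivClass (κ : V → ℕ → ℝ) : Type _ := Quotient (Setoid.ker κ)

/-- The equivalence class of a vertex. -/
def DerivClass.of (κ : V → ℕ → ℝ) (v : V) : DerivClass κ := Quotient.mk (Setoid.ker κ) v

noncomputable instance (κ : V → ℕ → ℝ) : DecidableEq (DerivClass κ) := Classical.decEq _

instance (κ : V → ℕ → ℝ) [Finite V] : Finite (DerivClass κ) :=
  inferInstanceAs (Finite (Quotient (Setoid.ker κ)))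

noncomputable instance (κ : V → ℕ → ℝ) [Finite V] : Fintype (DerivClass κ) := Fintype.ofFinite _

/-- `S_e(x)`, the maximizers of `x` on `e`. -/
def argmaxSet (x : V → ℝ) (e : Finset V) : Set V := {u | u ∈ e ∧ ∀ v ∈ e, x v ≤ x u}

/-- `I_e(x)`, the minimizers of `x` on `e`. -/
def argminSet (x : V → ℝ) (e : Finset V) : Set V := {u | u ∈ e ∧ ∀ v ∈ e, x u ≤ x v}

/-- `S_e^σ*`: the members of `S_e` in the highest class. -/
def topSet (κ : V → ℕ → ℝ) (e : Finset V) : Set V :=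
  {u | u ∈ argmaxSet (fun v => κ v 0) e ∧
    ∀ v ∈ argmaxSet (fun v => κ v 0) e, LexAboveEq κ u v}

/-- `I_e^σ*`: the members of `I_e` in the lowest class. -/
def bottomSet (κ : V → ℕ → ℝ) (e : Finset V) : Set V :=
  {u | u ∈ argminSet (fun v => κ v 0) e ∧
    ∀ v ∈ argminSet (fun v => κ v 0) e, LexAboveEq κ v u}

/-- The set `A` of vertices meets the class `U`. -/
def Meets (κ : V → ℕ → ℝ) (A : Set V) (U : DerivClass κ) : Prop :=
  ∃ u ∈ A, DerivClass.of κ u = U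

open Classical in
/-- Sums of a vector over the classes. -/
noncomputable def aggregate [Fintype V] (κ : V → ℕ → ℝ) (x : V → ℝ) (U : DerivClass κ) : ℝ :=
  ∑ v : V with DerivClass.of κ v = U, x v

theorem LexAboveEq.antisymm {κ : V → ℕ → ℝ} {u v : V} (h : LexAboveEq κ u v)
    (h' : LexAboveEq κ v u) : κ u = κ v := by
  rcases h with h | ⟨l, hl, hlt⟩
  · exact h
  rcases h' with h' | ⟨m, hm, hmt⟩
  · exact h'.symm
  rcases lt_trichotomy l m with hlm | rfl | hlm
  · exact absurd (hm l hlm) hlt.ne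
  · exact absurd hlt hmt.asymm
  · exact absurd (hl m hlm) hmt.ne

theorem Meets.topSet_unique {κ : V → ℕ → ℝ} {e : Finset V} {U U' : DerivClass κ}
    (h : Meets κ (topSet κ e) U) (h' : Meets κ (topSet κ e) U') : U = U' := by
  obtain ⟨u, hu, rfl⟩ := h
  obtain ⟨v, hv, rfl⟩ := h'
  exact Quotient.sound (LexAboveEq.antisymm (hu.2 v hv.1) (hv.2 u hu.1))

theorem Meets.bottomSet_unique {κ : V → ℕ → ℝ} {e : Finset V} {U U' : DerivClass κ}
    (h : Meets κ (bottomSet κ e) U) (h' : Meets κ (bottomSet κ e) U') : U = U' := by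
  obtain ⟨u, hu, rfl⟩ := h
  obtain ⟨v, hv, rfl⟩ := h'
  exact Quotient.sound (LexAboveEq.antisymm (hv.2 u hu.1) (hu.2 v hv.1))

theorem Meets.mono {κ : V → ℕ → ℝ} {A B : Set V} {U : DerivClass κ} (hAB : A ⊆ B)
    (h : Meets κ A U) : Meets κ B U := by
  obtain ⟨u, hu, h⟩ := h
  exact ⟨u, hAB hu, h⟩

end OrderedEquivalence

namespace WeightedHypergraph

set_option linter.unusedSectionVars false

variable {V : Type*} [Fintype V] [DecidableEq V]

/-- Weighted degree. -/
def degree (G : WeightedHypergraph V) (v : V) : ℝ := ∑ e ∈ G.edges with v ∈ e, G.weight e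

/-- The polytope `B_e`, the convex hull of the vectors `1_u - 1_v` with `u, v ∈ e`. -/
def basePolytope (e : Finset V) : Set (V → ℝ) :=
  convexHull ℝ {b | ∃ u ∈ e, ∃ v ∈ e, b = Pi.single u 1 - Pi.single v 1}

/-- The multivalued hypergraph Laplacian
`L_G(x) = {∑ₑ w(e) bₑ bₑᵀ x | bₑ ∈ argmax_{b ∈ Bₑ} bᵀ x}`. -/
def laplacian (G : WeightedHypergraph V) (x : V → ℝ) : Set (V → ℝ) :=
  {y | ∃ b : Finset V → V → ℝ,
    (∀ e ∈ G.edges, b e ∈ basePolytope e ∧ IsMaxOn (fun c => c ⬝ᵥ x) (basePolytope e) (b e)) ∧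
    y = ∑ e ∈ G.edges, G.weight e • (b e ⬝ᵥ x) • b e}

/-- `ρ / d_G`. -/
noncomputable def potential (G : WeightedHypergraph V) (ρ : V → ℝ) (v : V) : ℝ := ρ v / G.degree v

/-- The normalized Laplacian `ρ ↦ L_G(D⁻¹ ρ)`. -/
def normalizedLaplacian (G : WeightedHypergraph V) (ρ : V → ℝ) : Set (V → ℝ) :=
  G.laplacian (G.potential ρ)

/-- The sequence of right derivatives, of all orders `k ≥ 0`, of `ρ / d_G` at time `t`. -/
noncomputable def derivSeq (G : WeightedHypergraph V) (ρ : ℝ → V → ℝ) (t : ℝ) (v : V) (k : ℕ) : ℝ :=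
  rightDeriv^[k] (fun τ => G.potential (ρ τ) v) t

open Classical in
/-- The total weight of the hyperedges `e` such that `S_e^σ*` meets `U` and `I_e^σ*` meets
`U'`. -/
noncomputable def flowWeight (G : WeightedHypergraph V) (κ : V → ℕ → ℝ) (U U' : DerivClass κ) : ℝ :=
  ∑ e ∈ G.edges with Meets κ (topSet κ e) U ∧ Meets κ (bottomSet κ e) U', G.weight e

/-- The weight of the contracted graph on the set of classes. -/
noncomputable def contractedWeight (G : WeightedHypergraph V) (κ : V → ℕ → ℝ)
    (U U' : DerivClass κ) : ℝ :=
  if U = U' then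
    aggregate κ G.degree U - ∑ U'' with U'' ≠ U, (G.flowWeight κ U U'' + G.flowWeight κ U'' U)
  else G.flowWeight κ U U' + G.flowWeight κ U' U

theorem flowWeight_nonneg (G : WeightedHypergraph V) (κ : V → ℕ → ℝ) (U U' : DerivClass κ) :
    0 ≤ G.flowWeight κ U U' := by
  classical
  unfold flowWeight
  refine Finset.sum_nonneg fun e he => ?_
  rw [Finset.mem_filter] at he
  exact G.weight_nonneg e he.1

theorem sum_flowWeight_le (G : WeightedHypergraph V) (κ : V → ℕ → ℝ) (U : DerivClass κ) :
    ∑ U'' with U'' ≠ U, (G.flowWeight κ U U'' + G.flowWeight κ U'' U) ≤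
      aggregate κ G.degree U := by
  classical
  have h1 : ∑ U'' with U'' ≠ U, (G.flowWeight κ U U'' + G.flowWeight κ U'' U) =
      ∑ e ∈ G.edges, ∑ U'' with U'' ≠ U,
        ((if Meets κ (topSet κ e) U ∧ Meets κ (bottomSet κ e) U'' then G.weight e else 0) +
         (if Meets κ (topSet κ e) U'' ∧ Meets κ (bottomSet κ e) U then G.weight e else 0)) := by
    rw [Finset.sum_comm]
    refine Finset.sum_congr rfl fun U'' _ => ?_
    rw [Finset.sum_add_distrib, flowWeight, flowWeight, Finset.sum_filter, Finset.sum_filter]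
  have h2 : aggregate κ G.degree U =
      ∑ e ∈ G.edges, ∑ v : V with DerivClass.of κ v = U, (if v ∈ e then G.weight e else 0) := by
    rw [Finset.sum_comm]
    refine Finset.sum_congr (by ext; simp) fun v _ => ?_
    rw [degree, Finset.sum_filter]
  rw [h1, h2]
  refine Finset.sum_le_sum fun e he => ?_
  have hw := G.weight_nonneg e he
  have hpos : ∀ v ∈ Finset.univ.filter (fun v : V => DerivClass.of κ v = U),
      (0 : ℝ) ≤ if v ∈ e then G.weight e else 0 := fun v _ => by split_ifs <;> simp [hw]
  by_cases hU : ∃ v ∈ e, DerivClass.of κ v = U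
  · obtain ⟨v, hv, hvU⟩ := hU
    refine le_trans ?_ (Finset.single_le_sum hpos (a := v) (by simp [hvU]))
    rw [if_pos hv]
    by_cases ht : Meets κ (topSet κ e) U
    · by_cases hb : Meets κ (bottomSet κ e) U
      · refine le_trans (Finset.sum_nonpos fun U'' hU'' => ?_) hw
        have hne : U'' ≠ U := (Finset.mem_filter.1 hU'').2
        rw [if_neg, if_neg, add_zero]
        · exact fun h => hne (h.1.topSet_unique ht)
        · exact fun h => hne (h.2.bottomSet_unique hb)
      · simp only [ht, hb, and_false, true_and, if_false, add_zero]
        rw [← Finset.sum_filter]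
        refine le_trans (le_of_eq (Finset.sum_const _)) ?_
        rw [nsmul_eq_mul]
        refine mul_le_of_le_one_left hw ?_
        norm_cast
        refine Finset.card_le_one.2 fun a ha b hb => ?_
        exact (Finset.mem_filter.1 ha).2.bottomSet_unique (Finset.mem_filter.1 hb).2
    · simp only [ht, false_and, if_false, zero_add]
      rw [← Finset.sum_filter]
      refine le_trans (le_of_eq (Finset.sum_const _)) ?_
      rw [nsmul_eq_mul]
      refine mul_le_of_le_one_left hw ?_
      norm_cast
      refine Finset.card_le_one.2 fun a ha b hb => ?_
      exact (Finset.mem_filter.1 ha).2.1.topSet_unique (Finset.mem_filter.1 hb).2.1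
  · refine le_trans (Finset.sum_nonpos fun U'' _ => ?_) (Finset.sum_nonneg hpos)
    rw [if_neg, if_neg, add_zero]
    · rintro ⟨-, v, hv, h⟩
      exact hU ⟨v, hv.1.1, h⟩
    · rintro ⟨⟨v, hv, h⟩, -⟩
      exact hU ⟨v, hv.1.1, h⟩

/-- The contracted graph on the set of classes. -/
noncomputable def contractedGraph (G : WeightedHypergraph V) (κ : V → ℕ → ℝ) :
    WeightedGraph (DerivClass κ) where
  weight := G.contractedWeight κ
  weight_symm U U' := by
    by_cases h : U = U'
    · rw [h]
    · rw [contractedWeight, contractedWeight, if_neg h, if_neg (Ne.symm h), add_comm]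
  weight_nonneg U U' := by
    rw [contractedWeight]
    split_ifs with h
    · exact sub_nonneg.2 (G.sum_flowWeight_le κ U)
    · exact add_nonneg (G.flowWeight_nonneg κ U U') (G.flowWeight_nonneg κ U' U)

/-- No tie occurs before time `T`: the sets `S_e^σ*` and `I_e^σ*`, with `σ*` retaken at time `t`,
are the same for all `t ∈ [0, T)`. -/
def NoTieBefore (G : WeightedHypergraph V) (ρ : ℝ → V → ℝ) (T : ℝ) : Prop :=
  ∀ t ∈ Set.Ico 0 T, ∀ e ∈ G.edges,
    topSet (G.derivSeq ρ t) e = topSet (G.derivSeq ρ 0) e ∧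
    bottomSet (G.derivSeq ρ t) e = bottomSet (G.derivSeq ρ 0) e

end WeightedHypergraph

/-!
The heat equation is the gradient flow `D dμ/dt ∈ -∂Q(μ)` of the convex piecewise quadratic energy
`Q(x) = ½ ∑ₑ w(e) (maxₑ x - minₑ x)²`, and the heart of the matter is that its solutions are
real-analytic to the right of every time (`exists_analytic_right_continuation`).

*Local analyticity.*  Write the equation with flows `f ≥ 0` along the pairs `(u, v)` of vertices of a
common hyperedge. Membership in the Laplacian becomes complementary slackness
(`sum_flow_mem_laplacian`), and the heat equation becomes a linear complementarity system
`0 ≤ f ⊥ N f + P ∫ f - q ≥ 0` with positive semidefinite matrices `N` and `P`. Its formal Laplace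
transform is, for each `ε > 0`, the linear complementarity problem with matrix `N + ε P`. This one is
solved by minimizing a quadratic form over the orthant, and a solution of minimal support is the
unique solution of a linear system on its support. As there are finitely many supports, a single one
occurs for arbitrarily small `ε`. On it, simultaneous diagonalization of `N` and `P` shows that the
solution is a sum of simple fractions `a (1 + b ε)⁻¹` with `b ≥ 0`, the transforms of
`a exp (-b t)`. The sign of an analytic germ at `0⁺` is that of its first nonzero derivative, and the
transform multiplies the `k`-th derivative at `0` by `k!`, so that the inequalities and equalities
valid for small `ε` are valid for small `t` after inverting the transform
(`IsBorelLaplacePair.eventually_nonneg`, `exists_analytic_complementarity_system`). The Laplacian is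
monotone, so that the given solution coincides with the local analytic one.

*Consequences.*  The right derivatives are the derivatives of the local analytic functions, and just
after a time `t` the vertices are ordered by the lexicographic order of the derivatives at `t`; hence
no tie occurs for a short time. Moreover, the times at which two vertices have equal values but
different derivatives are isolated from the right, hence countable.

*Until the next tie.*  Let `Y` be the analytic function on the line that agrees with `μ` near `0⁺`.
Before the next tie, at almost every time the extremal sets of each hyperedge are its top and bottom
sets at time `0`. Tested against a vector `φ` constant on these sets, the equation therefore becomes
linear: `⟨φ, D dμ/dt⟩ = -𝓔(φ, μ)`, where `𝓔` is the form of a graph. By analyticity `Y` satisfies the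
same equation at all times, and it is constant on the equivalence classes at time `0`. As `μ - Y` is
constant on the top and bottom sets, it can serve as a test vector, and its energy is nonincreasing;
so `μ = Y` until the next tie (`NoTieBefore.exists_analytic_extension`). Testing against the indicator
of a class gives the heat equation of the contracted graph.
-/

open Set Filter MeasureTheory
open scoped Topology

/-! ### Absolutely continuous functions and energy estimates -/

theorem LipschitzWith.comp_absolutelyContinuousOnInterval {E F : Type*} [PseudoMetricSpace E]
    [PseudoMetricSpace F] {K : NNReal} {g : E → F} (hg : LipschitzWith K g) {f : ℝ → E} {a b : ℝ}
    (hf : AbsolutelyContinuousOnInterval f a b) :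
    AbsolutelyContinuousOnInterval (fun t => g (f t)) a b := by
  unfold AbsolutelyContinuousOnInterval at *
  refine squeeze_zero (fun t => Finset.sum_nonneg fun i _ => dist_nonneg) (fun t => ?_)
    (by simpa using hf.const_mul (K : ℝ))
  rw [Finset.mul_sum]
  exact Finset.sum_le_sum fun i _ => hg.dist_le_mul _ _

theorem AbsolutelyContinuousOnInterval.apply {X : Type*} [Fintype X] {f : ℝ → X → ℝ} {a b : ℝ}
    (hf : AbsolutelyContinuousOnInterval f a b) (x : X) :
    AbsolutelyContinuousOnInterval (fun t => f t x) a b := by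
  have hx : LipschitzWith 1 (Function.eval x : (X → ℝ) → ℝ) := LipschitzWith.eval x
  exact hx.comp_absolutelyContinuousOnInterval hf

theorem AbsolutelyContinuousOnInterval.finset_sum {X : Type*} (s : Finset X) {f : X → ℝ → ℝ}
    {a b : ℝ} (hf : ∀ x ∈ s, AbsolutelyContinuousOnInterval (f x) a b) :
    AbsolutelyContinuousOnInterval (fun t => ∑ x ∈ s, f x t) a b := by
  classical
  induction s using Finset.induction_on with
  | empty =>
    exact (LipschitzWith.const (0 : ℝ)).lipschitzOnWith.absolutelyContinuousOnInterval
  | insert x s hx ih =>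
    simp only [Finset.sum_insert hx]
    exact (hf x (by simp)).fun_add (ih fun y hy => hf y (by simp [hy]))

theorem AbsolutelyContinuousOnInterval.le_of_ae_deriv_nonpos {f : ℝ → ℝ} {a b : ℝ} (hab : a ≤ b)
    (hf : AbsolutelyContinuousOnInterval f a b)
    (h : ∀ᵐ t, t ∈ Ioo a b → ∃ f' ≤ 0, HasDerivAt f f' t) : f b ≤ f a := by
  rw [← sub_nonpos, ← hf.integral_deriv_eq_sub, intervalIntegral.integral_of_le hab,
    integral_Ioc_eq_integral_Ioo]
  refine setIntegral_nonpos_ae measurableSet_Ioo ?_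
  filter_upwards [h] with t ht htI
  obtain ⟨f', hf', hd⟩ := ht htI
  rwa [hd.deriv]

/-- A vector-valued function that vanishes at `a` and whose weighted squared norm has nonpositive
derivative almost everywhere vanishes identically. -/
theorem AbsolutelyContinuousOnInterval.eq_zero_of_energy_nonincreasing {X : Type*} [Fintype X]
    {m : X → ℝ} (hm : ∀ x, 0 < m x) {z : ℝ → X → ℝ} {a b : ℝ} (hab : a ≤ b)
    (hz : ∀ x, AbsolutelyContinuousOnInterval (fun t => z t x) a b) (h0 : z a = 0)
    (h : ∀ᵐ t, t ∈ Ioo a b → ∃ z' : X → ℝ,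
      (∀ x, HasDerivAt (fun t => z t x) (z' x) t) ∧ ∑ x, m x * z t x * z' x ≤ 0) :
    z b = 0 := by
  have hE : AbsolutelyContinuousOnInterval (fun t => ∑ x, m x * (z t x * z t x)) a b :=
    .finset_sum _ fun x _ => ((hz x).fun_mul (hz x)).const_mul _
  have hle := hE.le_of_ae_deriv_nonpos hab (by
    filter_upwards [h] with t ht htI
    obtain ⟨z', hdx, hle⟩ := ht htI
    refine ⟨_, ?_, HasDerivAt.fun_sum fun x _ => ((hdx x).mul (hdx x)).const_mul (m x)⟩
    calc ∑ x, m x * (z' x * z t x + z t x * z' x) = 2 * ∑ x, m x * z t x * z' x := by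
          rw [Finset.mul_sum]; exact Finset.sum_congr rfl fun x _ => by ring
      _ ≤ 0 := by linarith)
  simp only [h0, Pi.zero_apply, mul_zero, Finset.sum_const_zero] at hle
  have hnn : ∀ x ∈ Finset.univ, 0 ≤ m x * (z b x * z b x) := fun x _ =>
    mul_nonneg (hm x).le (mul_self_nonneg _)
  have hz0 := (Finset.sum_eq_zero_iff_of_nonneg hnn).1 (le_antisymm hle (Finset.sum_nonneg hnn))
  funext x
  have := hz0 x (Finset.mem_univ x)
  simpa [(hm x).ne'] using this

/-! ### Germs of real-analytic functions and the Borel-Laplace transform -/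

theorem AnalyticAt.eventually_pos_of_iteratedDeriv_pos {f : ℝ → ℝ} {x : ℝ} {n : ℕ}
    (hf : AnalyticAt ℝ f x) (h0 : ∀ k < n, iteratedDeriv k f x = 0)
    (hn : 0 < iteratedDeriv n f x) : ∀ᶠ t in 𝓝[>] x, 0 < f t := by
  induction n generalizing f with
  | zero =>
    rw [iteratedDeriv_zero] at hn
    exact (hf.continuousAt.eventually (lt_mem_nhds hn)).filter_mono nhdsWithin_le_nhds
  | succ n ih =>
    have hd := ih hf.deriv (fun k hk => by rw [← iteratedDeriv_succ']; exact h0 _ (by omega))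
      (by rwa [← iteratedDeriv_succ'])
    have hfx : f x = 0 := by simpa using h0 0 (by omega)
    obtain ⟨u, hu, hus⟩ := mem_nhdsGT_iff_exists_Ioo_subset.1 hd
    have hc : ∀ᶠ t in 𝓝 x, ContinuousAt f t :=
      hf.eventually_analyticAt.mono fun t ht => ht.continuousAt
    obtain ⟨l, r, ⟨hl, hr⟩, hlr⟩ := mem_nhds_iff_exists_Ioo_subset.1 hc
    have hlt : x < min u r := lt_min hu hr
    have hmono : StrictMonoOn f (Ico x (min u r)) := by
      refine strictMonoOn_of_deriv_pos (convex_Ico _ _) (fun t ht => ?_) fun t ht => ?_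
      · exact (hlr ⟨hl.trans_le ht.1, ht.2.trans_le (min_le_right _ _)⟩).continuousWithinAt
      · rw [interior_Ico] at ht
        exact hus ⟨ht.1, ht.2.trans_le (min_le_left _ _)⟩
    filter_upwards [Ioo_mem_nhdsGT hlt] with t ht
    rw [← hfx]
    exact hmono (left_mem_Ico.2 hlt) ⟨ht.1.le, ht.2⟩ ht.1

theorem AnalyticAt.eventually_eq_zero_of_iteratedDeriv_eq_zero {f : ℝ → ℝ} {x : ℝ}
    (hf : AnalyticAt ℝ f x) (h : ∀ k, iteratedDeriv k f x = 0) : ∀ᶠ t in 𝓝 x, f t = 0 := by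
  rw [← analyticOrderAt_eq_top, ENat.eq_top_iff_forall_ge]
  exact fun n => (natCast_le_analyticOrderAt_iff_iteratedDeriv_eq_zero hf).2 fun k _ => h k

/-- Trichotomy for the germ of a real-analytic function at the right of a point, by the sign of
its first nonvanishing derivative. -/
theorem AnalyticAt.eventually_sign_trichotomy {f : ℝ → ℝ} {x : ℝ} (hf : AnalyticAt ℝ f x) :
    ((∀ k, iteratedDeriv k f x = 0) ∧ ∀ᶠ t in 𝓝 x, f t = 0) ∨
    ((∃ n, (∀ k < n, iteratedDeriv k f x = 0) ∧ 0 < iteratedDeriv n f x) ∧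
      ∀ᶠ t in 𝓝[>] x, 0 < f t) ∨
    ((∃ n, (∀ k < n, iteratedDeriv k f x = 0) ∧ iteratedDeriv n f x < 0) ∧
      ∀ᶠ t in 𝓝[>] x, f t < 0) := by
  classical
  by_cases h : ∀ k, iteratedDeriv k f x = 0
  · exact .inl ⟨h, hf.eventually_eq_zero_of_iteratedDeriv_eq_zero h⟩
  push Not at h
  have hlt : ∀ k < Nat.find h, iteratedDeriv k f x = 0 := fun k hk => by
    simpa using Nat.find_min h hk
  rcases lt_or_gt_of_ne (Nat.find_spec h) with hn | hn
  · refine .inr (.inr ⟨⟨_, hlt, hn⟩, ?_⟩)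
    have := hf.neg.eventually_pos_of_iteratedDeriv_pos (n := Nat.find h)
      (fun k hk => by rw [iteratedDeriv_neg, hlt k hk, neg_zero])
      (by rw [iteratedDeriv_neg]; linarith)
    filter_upwards [this] with t ht
    simpa using ht
  · exact .inr (.inl ⟨⟨_, hlt, hn⟩, hf.eventually_pos_of_iteratedDeriv_pos hlt hn⟩)

theorem iteratedDeriv_succ_id_mul {f : ℝ → ℝ} (hf : AnalyticAt ℝ f 0) (k : ℕ) :
    iteratedDeriv (k + 1) (fun x => x * f x) 0 = (k + 1) * iteratedDeriv k f 0 := by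
  rw [iteratedDeriv_fun_mul contDiffAt_fun_id hf.contDiffAt, Finset.sum_eq_single 1]
  · simp [iteratedDeriv_one]
  · intro i _ hi
    rcases i with _ | _ | i
    · simp
    · exact absurd rfl hi
    · have : iteratedDeriv (i + 2) (fun x : ℝ => x) 0 = 0 := by
        rw [iteratedDeriv_succ', deriv_id'', iteratedDeriv_succ', deriv_const',
          iteratedDeriv_const]
        simp
      simp [this]
  · simp

/-- `F` is the formal Borel-Laplace transform of `f` at `0`: if `f t = ∑ₖ cₖ tᵏ / k!`, then
`F ε = ∑ₖ cₖ εᵏ`, so that `F ε = ∫₀^∞ f (ε r) e⁻ʳ dr` whenever the integral converges. -/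
structure IsBorelLaplacePair (F f : ℝ → ℝ) : Prop where
  analyticAt_left : AnalyticAt ℝ F 0
  analyticAt_right : AnalyticAt ℝ f 0
  iteratedDeriv_eq : ∀ k : ℕ, iteratedDeriv k F 0 = k.factorial * iteratedDeriv k f 0

namespace IsBorelLaplacePair

variable {F G f g : ℝ → ℝ}

theorem const (c : ℝ) : IsBorelLaplacePair (fun _ => c) fun _ => c where
  analyticAt_left := analyticAt_const
  analyticAt_right := analyticAt_const
  iteratedDeriv_eq k := by
    cases k <;> simp [iteratedDeriv_const]

theorem add (h : IsBorelLaplacePair F f) (h' : IsBorelLaplacePair G g) :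
    IsBorelLaplacePair (fun x => F x + G x) fun x => f x + g x where
  analyticAt_left := h.1.add h'.1
  analyticAt_right := h.2.add h'.2
  iteratedDeriv_eq k := by
    rw [iteratedDeriv_fun_add h.1.contDiffAt h'.1.contDiffAt,
      iteratedDeriv_fun_add h.2.contDiffAt h'.2.contDiffAt, h.3, h'.3, mul_add]

theorem const_mul (c : ℝ) (h : IsBorelLaplacePair F f) :
    IsBorelLaplacePair (fun x => c * F x) fun x => c * f x where
  analyticAt_left := analyticAt_const.mul h.1
  analyticAt_right := analyticAt_const.mul h.2
  iteratedDeriv_eq k := by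
    rw [iteratedDeriv_const_mul_field, iteratedDeriv_const_mul_field, h.3]
    ring

theorem sum {ι : Type*} (s : Finset ι) {F f : ι → ℝ → ℝ}
    (h : ∀ i ∈ s, IsBorelLaplacePair (F i) (f i)) :
    IsBorelLaplacePair (fun x => ∑ i ∈ s, F i x) fun x => ∑ i ∈ s, f i x := by
  classical
  induction s using Finset.induction_on with
  | empty => simpa using const 0
  | insert i s hi ih =>
    simp only [Finset.sum_insert hi]
    exact (h i (by simp)).add (ih fun j hj => h j (by simp [hj]))

/-- Multiplication by the variable corresponds to integration from `0`. -/
theorem id_mul (h : IsBorelLaplacePair F f) (hg : AnalyticAt ℝ g 0) (hg0 : g 0 = 0)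
    (hgf : deriv g = f) : IsBorelLaplacePair (fun x => x * F x) g where
  analyticAt_left := analyticAt_id.mul h.1
  analyticAt_right := hg
  iteratedDeriv_eq k := by
    cases k with
    | zero => simp [hg0]
    | succ k =>
      rw [iteratedDeriv_succ_id_mul h.1, iteratedDeriv_succ' (f := g), hgf, h.3,
        Nat.factorial_succ]
      push_cast
      ring

/-- The transform of `t ↦ exp (-b t)` is `ε ↦ (1 + b ε)⁻¹`. -/
theorem exp_neg_mul (b : ℝ) :
    IsBorelLaplacePair (fun x => (1 + b * x)⁻¹) fun t => Real.exp (-b * t) where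
  analyticAt_left := AnalyticAt.inv (by fun_prop) (by simp)
  analyticAt_right := by fun_prop
  iteratedDeriv_eq k := by
    rw [iteratedDeriv_exp_const_mul]
    have hF : AnalyticAt ℝ (fun x : ℝ => (1 + b * x)⁻¹) 0 :=
      AnalyticAt.inv (by fun_prop) (by simp)
    induction k with
    | zero => simp
    | succ k ih =>
      -- `F = 1 - b ε F` near `0` gives the recursion `F⁽ᵏ⁺¹⁾(0) = -b (k + 1) F⁽ᵏ⁾(0)`.
      have hne : ∀ᶠ x : ℝ in 𝓝 0, 1 + b * x ≠ 0 := by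
        have hc : ContinuousAt (fun x : ℝ => 1 + b * x) 0 := by fun_prop
        exact hc.eventually_ne (by simp)
      have heq : (fun x : ℝ => (1 + b * x)⁻¹) =ᶠ[𝓝 0]
          fun x => 1 + -b * (x * (1 + b * x)⁻¹) := by
        filter_upwards [hne] with x hx
        field_simp
        ring
      rw [heq.iteratedDeriv_eq, iteratedDeriv_const_add (Nat.succ_pos k),
        iteratedDeriv_const_mul_field, iteratedDeriv_succ_id_mul hF, ih, Nat.factorial_succ]
      push_cast
      simp only [mul_zero, Real.exp_zero]
      ring

/-- A transform that is nonnegative arbitrarily close to the right of `0` comes from a function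
that is nonnegative on some interval to the right of `0`. -/
theorem eventually_nonneg (h : IsBorelLaplacePair F f) (hF : ∃ᶠ x in 𝓝[>] 0, 0 ≤ F x) :
    ∀ᶠ t in 𝓝[>] 0, 0 ≤ f t := by
  rcases h.2.eventually_sign_trichotomy with ⟨-, h0⟩ | ⟨-, h0⟩ | ⟨⟨n, hlt, hn⟩, -⟩
  · exact (h0.filter_mono nhdsWithin_le_nhds).mono fun t ht => ht.ge
  · exact h0.mono fun t ht => ht.le
  · exfalso
    have := h.1.neg.eventually_pos_of_iteratedDeriv_pos (n := n)
      (fun k hk => by rw [iteratedDeriv_neg, h.3, hlt k hk, mul_zero, neg_zero])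
      (by rw [iteratedDeriv_neg, h.3]
          have : (0 : ℝ) < n.factorial := by positivity
          nlinarith)
    obtain ⟨x, h1, h2⟩ := (hF.and_eventually this).exists
    simp only [Pi.neg_apply] at h2
    linarith

theorem eventually_eq_zero (h : IsBorelLaplacePair F f) (hF : ∃ᶠ x in 𝓝[>] 0, F x = 0) :
    ∀ᶠ t in 𝓝[>] 0, f t = 0 := by
  have h1 := h.eventually_nonneg (hF.mono fun x hx => hx.ge)
  have h2 := (h.const_mul (-1)).eventually_nonneg (hF.mono fun x hx => by simp [hx])
  filter_upwards [h1, h2] with t h1 h2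
  linarith

end IsBorelLaplacePair

/-! ### Linear complementarity problems and simultaneous diagonalization -/

section LinearComplementarity

open Matrix

variable {J : Type*} [Fintype J]

/-- `f` solves the linear complementarity problem with matrix `M` and right-hand side `q`:
`0 ≤ f`, `q ≤ M f`, and in each coordinate one of the two inequalities is an equality. -/
structure IsComplementaritySolution (M : Matrix J J ℝ) (q f : J → ℝ) : Prop where
  nonneg : ∀ j, 0 ≤ f j
  le_mulVec : ∀ j, q j ≤ (M *ᵥ f) j
  compl : ∀ j, f j * ((M *ᵥ f) j - q j) = 0

theorem sq_norm_le_dotProduct_self (f : J → ℝ) : ‖f‖ ^ 2 ≤ f ⬝ᵥ f := by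
  have h0 : 0 ≤ f ⬝ᵥ f := Finset.sum_nonneg fun j _ => mul_self_nonneg _
  have : ‖f‖ ≤ √(f ⬝ᵥ f) := by
    refine (pi_norm_le_iff_of_nonneg (Real.sqrt_nonneg _)).2 fun j => Real.le_sqrt_of_sq_le ?_
    rw [Real.norm_eq_abs, sq_abs, sq]
    exact Finset.single_le_sum (f := fun j => f j * f j) (fun j _ => mul_self_nonneg _)
      (Finset.mem_univ j)
  calc ‖f‖ ^ 2 ≤ √(f ⬝ᵥ f) ^ 2 := by gcongr
    _ = _ := Real.sq_sqrt h0

theorem dotProduct_le_norm_mul (q f : J → ℝ) : q ⬝ᵥ f ≤ (∑ j, |q j|) * ‖f‖ := by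
  rw [Finset.sum_mul]
  refine Finset.sum_le_sum fun j _ => (le_abs_self _).trans ?_
  rw [abs_mul]
  gcongr
  exact norm_le_pi_norm f j

/-- A minimizer over the orthant of `½ fᵀ M f - qᵀ f` solves the complementarity problem. -/
theorem exists_isComplementaritySolution {M : Matrix J J ℝ} (hM : M.IsHermitian) {c : ℝ}
    (hc : 0 < c) (hcoer : ∀ f : J → ℝ, (∀ j, 0 ≤ f j) → c * (f ⬝ᵥ f) ≤ f ⬝ᵥ M *ᵥ f)
    (q : J → ℝ) : ∃ f, IsComplementaritySolution M q f := by
  classical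
  let Φ : (J → ℝ) → ℝ := fun f => 2⁻¹ * (f ⬝ᵥ M *ᵥ f) - q ⬝ᵥ f
  have hcont : Continuous Φ := by
    have : Continuous fun f : J → ℝ => M *ᵥ f := continuous_const.matrix_mulVec continuous_id
    have h1 : Continuous fun f : J → ℝ => f ⬝ᵥ M *ᵥ f := continuous_id.dotProduct this
    have h2 : Continuous fun f : J → ℝ => q ⬝ᵥ f := continuous_const.dotProduct continuous_id
    exact (continuous_const.mul h1).sub h2
  obtain ⟨f, hf, hmin⟩ : ∃ f ∈ {f : J → ℝ | ∀ j, 0 ≤ f j},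
      IsMinOn Φ {f : J → ℝ | ∀ j, 0 ≤ f j} f := by
    refine hcont.continuousOn.exists_isMinOn' ?_ (x₀ := 0) (by simp) ?_
    · simp only [ofPred_forall]
      exact isClosed_iInter fun j => isClosed_le continuous_const (continuous_apply j)
    · have hbig := tendsto_norm_cocompact_atTop (E := J → ℝ)
      have := hbig.eventually_ge_atTop (2 * (∑ j, |q j|) / c)
      rw [eventually_inf_principal]
      filter_upwards [this] with f hf hf0
      have h1 := hcoer f hf0
      have h2 := sq_norm_le_dotProduct_self f
      have h3 := dotProduct_le_norm_mul q f
      rw [div_le_iff₀ hc] at hf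
      have h4 : (∑ j, |q j|) * ‖f‖ ≤ 2⁻¹ * (c * ‖f‖ ^ 2) := by
        nlinarith [norm_nonneg f]
      have h5 : c * ‖f‖ ^ 2 ≤ c * (f ⬝ᵥ f) := by gcongr
      have h6 : Φ 0 = 0 := by simp [Φ]
      rw [h6]
      simp only [Φ]
      linarith
  -- Variation of a single coordinate.
  have hvar : ∀ j h, -f j ≤ h → 0 ≤ h * ((M *ᵥ f) j - q j) + 2⁻¹ * (h ^ 2 * M j j) := by
    intro j h hh
    have hmem : f + h • Pi.single j 1 ∈ {f : J → ℝ | ∀ j, 0 ≤ f j} := by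
      intro i
      by_cases hij : i = j
      · subst hij; simp; linarith
      · simpa [hij] using hf i
    have := hmin hmem
    have hsym : f ⬝ᵥ M *ᵥ Pi.single j 1 = (M *ᵥ f) j := by
      rw [dotProduct_mulVec, ← mulVec_transpose, dotProduct_single_one]
      have hT : Mᵀ = M := by simpa [IsHermitian, conjTranspose_eq_transpose_of_trivial] using hM
      rw [hT]
    simp only [Φ, mem_ofPred_eq, mulVec_add, mulVec_smul, dotProduct_add, add_dotProduct,
      smul_dotProduct, dotProduct_smul, smul_eq_mul, hsym, single_one_dotProduct,
      dotProduct_single_one] at this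
    have hjj : (M *ᵥ Pi.single j 1) j = M j j := by simp
    rw [hjj] at this
    linarith
  -- Increasing the coordinate shows `q j ≤ (M f) j`, decreasing it (when `0 < f j`) the converse.
  have hge : ∀ j, 0 ≤ (M *ᵥ f) j - q j := by
    intro j
    by_contra! hneg
    set g := (M *ᵥ f) j - q j
    have hj : 0 ≤ |M j j| := abs_nonneg _
    have h0 : 0 < -g / (|M j j| + 1) := div_pos (by linarith) (by linarith)
    have := hvar j (-g / (|M j j| + 1)) (by linarith [hf j])
    set h := -g / (|M j j| + 1)
    have h2 : h * (|M j j| + 1) = -g := by simp only [h]; field_simp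
    have h3 : h ^ 2 * M j j ≤ h * (h * (|M j j| + 1)) := by nlinarith [le_abs_self (M j j)]
    rw [h2] at h3
    nlinarith
  refine ⟨f, hf, fun j => by linarith [hge j], fun j => ?_⟩
  rcases (hf j).eq_or_lt with h0 | hpos
  · simp [← h0]
  · refine mul_eq_zero_of_right _ (le_antisymm ?_ (hge j))
    by_contra! hneg
    set g := (M *ᵥ f) j - q j
    have hj : 0 ≤ |M j j| := abs_nonneg _
    set h := min (f j) (g / (|M j j| + 1)) with hh
    have h0 : 0 < h := lt_min hpos (div_pos hneg (by linarith))
    have := hvar j (-h) (by linarith [min_le_left (f j) (g / (|M j j| + 1))])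
    have h2 : h * (|M j j| + 1) ≤ g := by
      rw [← le_div_iff₀ (by linarith)]; exact min_le_right _ _
    have h3 : h ^ 2 * M j j ≤ h * (h * (|M j j| + 1)) := by nlinarith [le_abs_self (M j j)]
    nlinarith

/-- A solution of minimal support: the columns of `M` in its support are linearly independent. -/
theorem exists_isComplementaritySolution_injective {M : Matrix J J ℝ} (hM : M.IsHermitian) {c : ℝ}
    (hc : 0 < c) (hcoer : ∀ f : J → ℝ, (∀ j, 0 ≤ f j) → c * (f ⬝ᵥ f) ≤ f ⬝ᵥ M *ᵥ f)
    (q : J → ℝ) : ∃ f, IsComplementaritySolution M q f ∧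
      ∀ h : J → ℝ, (∀ j, f j = 0 → h j = 0) → M *ᵥ h = 0 → h = 0 := by
  classical
  obtain ⟨f, hf, hmin⟩ := WellFounded.has_min
    (measure fun f : J → ℝ => (Finset.univ.filter fun j => f j ≠ 0).card).wf
    {f | IsComplementaritySolution M q f} (exists_isComplementaritySolution hM hc hcoer q)
  refine ⟨f, hf, fun h hsupp hMh => ?_⟩
  by_contra hne
  -- Coercivity forces a negative coordinate, so that moving along `h` leaves the orthant.
  obtain ⟨i, hi⟩ : ∃ i, h i < 0 := by
    by_contra! hnn
    have h1 := hcoer h hnn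
    rw [hMh, dotProduct_zero] at h1
    have h2 : 0 < ‖h‖ := norm_pos_iff.2 hne
    have h3 : 0 < h ⬝ᵥ h := lt_of_lt_of_le (by positivity) (sq_norm_le_dotProduct_self h)
    have := mul_pos hc h3
    linarith
  obtain ⟨k, hk, hkmin⟩ := Finset.exists_min_image (Finset.univ.filter fun j => h j < 0)
    (fun j => f j / (-h j)) ⟨i, by simpa using hi⟩
  have hk : h k < 0 := by simpa using hk
  -- The first parameter at which a coordinate of `f + τ h` vanishes.
  set τ := f k / (-h k) with hτ
  have hτ0 : 0 ≤ τ := div_nonneg (hf.nonneg k) (by linarith)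
  have hMf : M *ᵥ (f + τ • h) = M *ᵥ f := by
    rw [mulVec_add, mulVec_smul, hMh, smul_zero, add_zero]
  have hsol : IsComplementaritySolution M q (f + τ • h) := by
    refine ⟨fun j => ?_, fun j => ?_, fun j => ?_⟩
    · simp only [Pi.add_apply, Pi.smul_apply, smul_eq_mul]
      rcases lt_or_ge (h j) 0 with hj | hj
      · have := hkmin j (by simpa using hj)
        have h2 : τ * (-h j) ≤ f j := by rwa [← le_div_iff₀ (by linarith)]
        linarith
      · have := hf.nonneg j
        positivity
    · rw [hMf]; exact hf.le_mulVec j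
    · rw [hMf]
      by_cases hj : f j = 0
      · simp [hj, hsupp j hj]
      · have : (M *ᵥ f) j - q j = 0 := (mul_eq_zero.1 (hf.compl j)).resolve_left hj
        simp [this]
  refine hmin _ hsol ?_
  refine Finset.card_lt_card ⟨fun j hj => ?_, fun hsub => ?_⟩
  · simp only [Finset.mem_filter, Finset.mem_univ, true_and, Pi.add_apply, Pi.smul_apply,
      smul_eq_mul] at hj ⊢
    intro h0
    exact hj (by rw [h0, hsupp j h0]; simp)
  · have hfk : f k ≠ 0 := fun h0 => hk.ne (hsupp k h0)
    have := hsub (Finset.mem_filter.2 ⟨Finset.mem_univ k, hfk⟩)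
    simp only [Finset.mem_filter, Finset.mem_univ, true_and, Pi.add_apply, Pi.smul_apply,
      smul_eq_mul, hτ] at this
    apply this
    field_simp [hk.ne]
    ring

variable [DecidableEq J]

open scoped MatrixOrder in
/-- Simultaneous diagonalization of two positive semidefinite forms with positive definite sum. -/
theorem Matrix.PosSemidef.exists_simultaneous_diagonalization {N P : Matrix J J ℝ}
    (hN : N.PosSemidef) (hP : P.PosSemidef) (hNP : (N + P).PosDef) :
    ∃ (R : Matrix J J ℝ) (l : J → ℝ), IsUnit R ∧ (∀ i, 0 ≤ l i ∧ l i ≤ 1) ∧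
      N = Rᵀ * diagonal l * R ∧ P = Rᵀ * diagonal (fun i => 1 - l i) * R := by
  obtain ⟨B, hB⟩ := CStarAlgebra.nonneg_iff_eq_star_mul_self.mp hNP.posSemidef.nonneg
  rw [star_eq_conjTranspose, conjTranspose_eq_transpose_of_trivial] at hB
  have hBu : IsUnit B := by
    have h := hNP.isUnit
    rw [hB, isUnit_iff_isUnit_det, det_mul, det_transpose] at h
    exact (isUnit_iff_isUnit_det _).2 (isUnit_of_mul_isUnit_right h)
  have hdet : IsUnit B.det := (isUnit_iff_isUnit_det _).1 hBu
  have hdetT : IsUnit Bᵀ.det := by rwa [det_transpose]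
  have hC : ((B⁻¹)ᴴ * N * B⁻¹).PosSemidef := hN.conjTranspose_mul_mul_same _
  set C := (B⁻¹)ᴴ * N * B⁻¹ with hCdef
  have hBC : Bᵀ * C * B = N := by
    rw [hCdef, conjTranspose_eq_transpose_of_trivial, transpose_nonsing_inv]
    calc Bᵀ * ((Bᵀ)⁻¹ * N * B⁻¹) * B = (Bᵀ * (Bᵀ)⁻¹) * N * (B⁻¹ * B) := by
          simp only [Matrix.mul_assoc]
      _ = N := by rw [mul_nonsing_inv _ hdetT, nonsing_inv_mul _ hdet, Matrix.one_mul,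
          Matrix.mul_one]
  set U : Matrix J J ℝ := (hC.1.eigenvectorUnitary : Matrix J J ℝ) with hU
  have hUU : U * Uᵀ = 1 := by
    have := Unitary.mul_star_self_of_mem hC.1.eigenvectorUnitary.2
    rwa [star_eq_conjTranspose, conjTranspose_eq_transpose_of_trivial] at this
  have hUU' : Uᵀ * U = 1 := mul_eq_one_comm.1 hUU
  set l := hC.1.eigenvalues with hl
  have hspec : C = U * diagonal l * Uᵀ := by
    have := hC.1.spectral_theorem
    rw [Unitary.conjStarAlgAut_apply] at this
    rw [star_eq_conjTranspose, conjTranspose_eq_transpose_of_trivial] at this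
    exact this
  have hUu : IsUnit Uᵀ := IsUnit.of_mul_eq_one _ hUU'
  have hRu : IsUnit (Uᵀ * B) := hUu.mul hBu
  have hNeq : N = (Uᵀ * B)ᵀ * diagonal l * (Uᵀ * B) := by
    rw [transpose_mul, transpose_transpose, ← hBC, hspec]
    simp only [Matrix.mul_assoc]
  have hPeq : P = (Uᵀ * B)ᵀ * diagonal (fun i => 1 - l i) * (Uᵀ * B) := by
    have h1 : diagonal (fun i => 1 - l i) = 1 - diagonal l := by
      rw [← diagonal_one, diagonal_sub]
    have h2 : (Uᵀ * B)ᵀ * (Uᵀ * B) = N + P := by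
      rw [transpose_mul, transpose_transpose, hB]
      calc Bᵀ * U * (Uᵀ * B) = Bᵀ * (U * Uᵀ) * B := by simp only [Matrix.mul_assoc]
        _ = _ := by rw [hUU, Matrix.mul_one]
    rw [h1, Matrix.mul_sub, Matrix.sub_mul, Matrix.mul_one, ← hNeq, h2]
    abel
  refine ⟨Uᵀ * B, l, hRu, fun i => ⟨hC.eigenvalues_nonneg i, ?_⟩, hNeq, hPeq⟩
  have hD : (diagonal fun i => 1 - l i).PosSemidef := by
    rw [hPeq, ← conjTranspose_eq_transpose_of_trivial] at hP
    exact (IsUnit.posSemidef_star_left_conjugate_iff hRu).1 hP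
  have := posSemidef_diagonal_iff.1 hD i
  linarith

end LinearComplementarity

/-! ### Analytic solutions of linear complementarity systems -/

section LinearComplementaritySystem

open Matrix

variable {J : Type*} [Fintype J] [DecidableEq J]

/-- The resolvents `(N + ε P)⁻¹ q` of a pencil of positive semidefinite matrices are sums of simple
fractions `a (1 + b ε)⁻¹`, as soon as they do not blow up as `ε → 0`. -/
theorem Matrix.PosSemidef.exists_resolvent_eq_sum_inv {N P : Matrix J J ℝ} (hN : N.PosSemidef)
    (hP : P.PosSemidef) (hNP : (N + P).PosDef) (q : J → ℝ) {K : ℝ}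
    (hfreq : ∃ᶠ ε in 𝓝[>] (0 : ℝ), ∃ f : J → ℝ, ‖f‖ ≤ K ∧ (N + ε • P) *ᵥ f = q) :
    ∃ (A : Matrix J J ℝ) (b : J → ℝ), ∀ ε > 0, ∀ f : J → ℝ,
      (N + ε • P) *ᵥ f = q → ∀ j, f j = ∑ i, A j i * (1 + b i * ε)⁻¹ := by
  obtain ⟨R, l, hR, hl, rfl, rfl⟩ := hN.exists_simultaneous_diagonalization hP hNP
  have hRdet : IsUnit R.det := (isUnit_iff_isUnit_det _).1 hR
  have hRTdet : IsUnit Rᵀ.det := by rwa [det_transpose]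
  set p := (Rᵀ)⁻¹ *ᵥ q with hp
  have hden : ∀ ε > 0, ∀ i, 0 < l i + ε * (1 - l i) := by
    intro ε hε i
    rcases (hl i).1.eq_or_lt with h | h
    · rw [← h]; linarith
    · have := mul_nonneg hε.le (sub_nonneg.2 (hl i).2); linarith
  -- In the coordinates `R f` the linear system is diagonal.
  have hsolve : ∀ (ε : ℝ) (f : J → ℝ),
      (Rᵀ * diagonal l * R + ε • (Rᵀ * diagonal (fun i => 1 - l i) * R)) *ᵥ f = q →
      ∀ i, (l i + ε * (1 - l i)) * (R *ᵥ f) i = p i := by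
    intro ε f hf i
    rw [hp, ← hf, add_mulVec, smul_mulVec, mulVec_add, mulVec_smul]
    simp only [← mulVec_mulVec]
    rw [mulVec_mulVec _ (Rᵀ)⁻¹, mulVec_mulVec _ (Rᵀ)⁻¹, nonsing_inv_mul _ hRTdet, one_mulVec,
      one_mulVec]
    simp only [Pi.add_apply, Pi.smul_apply, mulVec_diagonal, smul_eq_mul]
    ring
  -- Boundedness excludes the poles at `ε = 0`.
  have hpole : ∀ i, l i = 0 → p i = 0 := by
    intro i hi
    set K' := (∑ j, |R i j|) * K
    have hle : ∃ᶠ ε in 𝓝[>] (0 : ℝ), |p i| ≤ ε * K' := by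
      refine (hfreq.and_eventually self_mem_nhdsWithin).mono ?_
      rintro ε ⟨⟨f, hfK, hf⟩, hε⟩
      have hε : 0 < ε := hε
      rw [← hsolve ε f hf i, hi, zero_add, sub_zero, mul_one, abs_mul, abs_of_pos hε]
      gcongr
      have h1 : |(R *ᵥ f) i| ≤ (∑ j, |R i j|) * ‖f‖ := by
        rw [Finset.sum_mul]
        refine (Finset.abs_sum_le_sum_abs _ _).trans (Finset.sum_le_sum fun j _ => ?_)
        rw [abs_mul]
        gcongr
        exact norm_le_pi_norm f j
      exact h1.trans (mul_le_mul_of_nonneg_left hfK (Finset.sum_nonneg fun j _ => abs_nonneg _))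
    by_contra hne
    have hpos : 0 < |p i| := abs_pos.2 hne
    have hev : ∀ᶠ ε in 𝓝[>] (0 : ℝ), ε * K' < |p i| := by
      have hc : ContinuousAt (fun ε : ℝ => ε * K') 0 := by fun_prop
      exact (hc.eventually (gt_mem_nhds (by simpa using hpos))).filter_mono nhdsWithin_le_nhds
    obtain ⟨ε, h1, h2⟩ := (hle.and_eventually hev).exists
    linarith
  -- If `l i = 0`, then `p i = 0` and the coefficient `p i / l i` is `0` as well.
  refine ⟨R⁻¹ * diagonal fun i => p i / l i, fun i => (1 - l i) / l i, fun ε hε f hf j => ?_⟩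
  have hRf : ∀ i, (R *ᵥ f) i = p i / l i * (1 + (1 - l i) / l i * ε)⁻¹ := by
    intro i
    have h := hsolve ε f hf i
    have hd := hden ε hε i
    by_cases hi : l i = 0
    · rw [hpole i hi] at h ⊢
      simpa [hd.ne'] using h
    · rw [← h]
      have : 1 + (1 - l i) / l i * ε = (l i + ε * (1 - l i)) / l i := by field_simp
      rw [this, inv_div]
      field_simp
  have : f = R⁻¹ *ᵥ (R *ᵥ f) := by
    rw [mulVec_mulVec, nonsing_inv_mul _ hRdet, one_mulVec]
  conv_lhs => rw [this]
  simp only [mulVec, dotProduct, mul_diagonal]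
  refine Finset.sum_congr rfl fun i _ => ?_
  have := hRf i
  simp only [mulVec, dotProduct] at this
  rw [this]
  ring

/-- The primitive of `t ↦ exp (-b t)` that vanishes at `0`. -/
noncomputable def expPrimitive (b t : ℝ) : ℝ :=
  if b = 0 then t else (1 - Real.exp (-b * t)) / b

theorem expPrimitive_zero (b : ℝ) : expPrimitive b 0 = 0 := by
  simp [expPrimitive]

theorem analyticAt_expPrimitive (b t : ℝ) : AnalyticAt ℝ (expPrimitive b) t := by
  by_cases hb : b = 0
  · have : expPrimitive b = fun t => t := by funext t; simp [expPrimitive, hb]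
    rw [this]; fun_prop
  · have : expPrimitive b = fun t => (1 - Real.exp (-b * t)) / b := by
      funext t; simp [expPrimitive, hb]
    rw [this]; fun_prop (disch := assumption)

theorem hasDerivAt_expPrimitive (b t : ℝ) :
    HasDerivAt (expPrimitive b) (Real.exp (-b * t)) t := by
  by_cases hb : b = 0
  · have : expPrimitive b = fun t => t := by funext t; simp [expPrimitive, hb]
    rw [this, hb]
    simpa using hasDerivAt_id' t
  · have : expPrimitive b = fun t => (1 - Real.exp (-b * t)) / b := by
      funext t; simp [expPrimitive, hb]
    rw [this]
    refine (((((hasDerivAt_id' t).const_mul (-b)).exp).const_sub 1).div_const b).congr_deriv ?_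
    rw [div_eq_iff hb]
    ring

theorem Matrix.posSemidef_diagonal_mul_mul_diagonal {N : Matrix J J ℝ} (hN : N.PosSemidef)
    (d : J → ℝ) : (diagonal d * N * diagonal d).PosSemidef := by
  have := hN.conjTranspose_mul_mul_same (diagonal d)
  rwa [diagonal_conjTranspose, star_trivial] at this

/-- **Local analytic solutions of linear complementarity systems.**  For positive semidefinite `N`
and `P`, with `N` coercive on the orthant, there are real-analytic `φ`, `f = φ'` such that
`φ 0 = 0` and, for small `t > 0`, `f t` solves the complementarity problem with matrix `N` and
right-hand side `q - P (φ t)`. -/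
theorem exists_analytic_complementarity_system {N P : Matrix J J ℝ} (hN : N.PosSemidef)
    (hP : P.PosSemidef) {c : ℝ} (hc : 0 < c)
    (hcoer : ∀ f : J → ℝ, (∀ j, 0 ≤ f j) → c * (f ⬝ᵥ f) ≤ f ⬝ᵥ N *ᵥ f) (q : J → ℝ) :
    ∃ φ f : ℝ → J → ℝ, (∀ j t, AnalyticAt ℝ (fun t => φ t j) t) ∧ φ 0 = 0 ∧
      (∀ j t, HasDerivAt (fun t => φ t j) (f t j) t) ∧
      ∀ᶠ t in 𝓝[>] (0 : ℝ), IsComplementaritySolution N (q - P *ᵥ φ t) (f t) := by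
  have hPnn : ∀ f : J → ℝ, 0 ≤ f ⬝ᵥ P *ᵥ f := fun f => by
    simpa using hP.dotProduct_mulVec_nonneg f
  have hcoerε : ∀ ε > (0 : ℝ), ∀ f : J → ℝ, (∀ j, 0 ≤ f j) →
      c * (f ⬝ᵥ f) ≤ f ⬝ᵥ (N + ε • P) *ᵥ f := by
    intro ε hε f hf
    rw [add_mulVec, smul_mulVec, dotProduct_add, dotProduct_smul, smul_eq_mul]
    have := mul_nonneg (le_of_lt hε) (hPnn f)
    linarith [hcoer f hf]
  -- Solutions at all `ε > 0`, with support `α`. The independence condition on the support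
  -- does not depend on `ε`, as `N + ε P` and `N + P` have the same kernel.
  have hex : ∀ ε > (0 : ℝ), ∃ α : Finset J, ∃ f, IsComplementaritySolution (N + ε • P) q f ∧
      (∀ j, j ∉ α ↔ f j = 0) ∧
      ∀ h : J → ℝ, (∀ j ∉ α, h j = 0) → N *ᵥ h = 0 → P *ᵥ h = 0 → h = 0 := by
    intro ε hε
    obtain ⟨f, hf, hinj⟩ := exists_isComplementaritySolution_injective
      (hN.add (hP.smul hε.le)).isHermitian hc (hcoerε ε hε) q
    refine ⟨Finset.univ.filter fun j => f j ≠ 0, f, hf, by simp, fun h hh h1 h2 =>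
      hinj h (fun j hj => hh j (by simpa using hj)) ?_⟩
    rw [add_mulVec, smul_mulVec, h1, h2, smul_zero, add_zero]
  obtain ⟨α, hα⟩ : ∃ α : Finset J, ∃ᶠ ε in 𝓝[>] (0 : ℝ),
      ∃ f, IsComplementaritySolution (N + ε • P) q f ∧ (∀ j, j ∉ α ↔ f j = 0) ∧
      ∀ h : J → ℝ, (∀ j ∉ α, h j = 0) → N *ᵥ h = 0 → P *ᵥ h = 0 → h = 0 := by
    by_contra hcon
    have hall : ∀ᶠ ε in 𝓝[>] (0 : ℝ), ∀ α : Finset J, ¬ ∃ f,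
        IsComplementaritySolution (N + ε • P) q f ∧ (∀ j, j ∉ α ↔ f j = 0) ∧
        ∀ h : J → ℝ, (∀ j ∉ α, h j = 0) → N *ᵥ h = 0 → P *ᵥ h = 0 → h = 0 :=
      eventually_all.2 fun α => not_frequently.1 (not_exists.1 hcon α)
    obtain ⟨ε, h1, h2⟩ := (hall.and self_mem_nhdsWithin).exists
    obtain ⟨α, h3⟩ := hex ε h2
    exact h1 α h3
  have hker : ∀ h : J → ℝ, (∀ j ∉ α, h j = 0) → N *ᵥ h = 0 → P *ᵥ h = 0 → h = 0 := by
    obtain ⟨ε, f, -, -, h⟩ := hα.exists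
    exact h
  -- Restrict to the coordinates in `α`, completing by the identity on the other ones.
  set d : J → ℝ := fun j => if j ∈ α then 1 else 0 with hd
  set d' : J → ℝ := fun j => if j ∈ α then 0 else 1 with hd'
  set N' := diagonal d * N * diagonal d with hN'
  set P' := diagonal d * P * diagonal d + diagonal d' with hP'
  have hN'psd : N'.PosSemidef := posSemidef_diagonal_mul_mul_diagonal hN d
  have hd'psd : (diagonal d').PosSemidef :=
    posSemidef_diagonal_iff.2 fun j => by simp only [hd']; split_ifs <;> norm_num
  have hdPpsd := posSemidef_diagonal_mul_mul_diagonal hP d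
  have hP'psd : P'.PosSemidef := hdPpsd.add hd'psd
  have hquad : ∀ (M : Matrix J J ℝ) (x : J → ℝ), x ⬝ᵥ (diagonal d * M * diagonal d) *ᵥ x =
      (diagonal d *ᵥ x) ⬝ᵥ M *ᵥ (diagonal d *ᵥ x) := by
    intro M x
    rw [← mulVec_mulVec, ← mulVec_mulVec, dotProduct_mulVec x, ← mulVec_transpose,
      diagonal_transpose]
  have hpd : (N' + P').PosDef := by
    refine .of_dotProduct_mulVec_pos (hN'psd.add hP'psd).isHermitian fun x hx => ?_
    rw [star_trivial]
    have h1 : 0 ≤ x ⬝ᵥ N' *ᵥ x := by simpa using hN'psd.dotProduct_mulVec_nonneg x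
    have h2 : 0 ≤ x ⬝ᵥ (diagonal d * P * diagonal d) *ᵥ x := by
      simpa using hdPpsd.dotProduct_mulVec_nonneg x
    have h3 : 0 ≤ x ⬝ᵥ diagonal d' *ᵥ x := by simpa using hd'psd.dotProduct_mulVec_nonneg x
    rw [hP', add_mulVec, add_mulVec, dotProduct_add, dotProduct_add]
    refine lt_of_le_of_ne (by positivity) fun h0 => hx ?_
    have e1 : x ⬝ᵥ N' *ᵥ x = 0 := by linarith
    have e2 : x ⬝ᵥ (diagonal d * P * diagonal d) *ᵥ x = 0 := by linarith
    have e3 : x ⬝ᵥ diagonal d' *ᵥ x = 0 := by linarith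
    have e4 : ∀ j ∉ α, x j = 0 := by
      have := (hd'psd.dotProduct_mulVec_zero_iff x).1 (by simpa using e3)
      intro j hj
      have h := congrFun this j
      simpa [mulVec_diagonal, hd', hj] using h
    have e5 : diagonal d *ᵥ x = x := by
      funext j
      by_cases hj : j ∈ α
      · simp [mulVec_diagonal, hd, hj]
      · simp [mulVec_diagonal, hd, hj, e4 j hj]
    rw [hN', hquad, e5] at e1
    rw [hquad, e5] at e2
    exact hker x e4 ((hN.dotProduct_mulVec_zero_iff x).1 (by simpa using e1))
      ((hP.dotProduct_mulVec_zero_iff x).1 (by simpa using e2))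
  set q' := diagonal d *ᵥ q with hq'
  have hred : ∀ (ε : ℝ) f, IsComplementaritySolution (N + ε • P) q f → (∀ j, j ∉ α ↔ f j = 0) →
      (N' + ε • P') *ᵥ f = q' := by
    intro ε f hf hsupp
    have e5 : diagonal d *ᵥ f = f := by
      funext j
      by_cases hj : j ∈ α
      · simp [mulVec_diagonal, hd, hj]
      · simp [mulVec_diagonal, hd, hj, (hsupp j).1 hj]
    have e6 : diagonal d' *ᵥ f = 0 := by
      funext j
      by_cases hj : j ∈ α
      · simp [mulVec_diagonal, hd', hj]
      · simp [mulVec_diagonal, (hsupp j).1 hj]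
    have e7 : (N' + ε • P') *ᵥ f = diagonal d *ᵥ ((N + ε • P) *ᵥ f) := by
      rw [hN', hP']
      simp only [add_mulVec, smul_mulVec, ← mulVec_mulVec, e5, e6, mulVec_add, mulVec_smul,
        add_zero]
    rw [e7, hq']
    funext j
    by_cases hj : j ∈ α
    · have hne : f j ≠ 0 := fun h0 => (hsupp j).2 h0 hj
      have := (mul_eq_zero.1 (hf.compl j)).resolve_left hne
      simp only [mulVec_diagonal]
      rw [sub_eq_zero.1 this]
    · simp [mulVec_diagonal, hd, hj]
  -- Coercivity bounds the solutions uniformly in `ε`.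
  set K := (∑ j, |q j|) / c with hK
  have hbound : ∀ ε > (0 : ℝ), ∀ f, IsComplementaritySolution (N + ε • P) q f → ‖f‖ ≤ K := by
    intro ε hε f hf
    have h1 := hcoerε ε hε f hf.nonneg
    have h2 : f ⬝ᵥ (N + ε • P) *ᵥ f = q ⬝ᵥ f := by
      refine Finset.sum_congr rfl fun j _ => ?_
      have := hf.compl j
      linarith
    have h3 := dotProduct_le_norm_mul q f
    have h4 := sq_norm_le_dotProduct_self f
    rw [hK, le_div_iff₀ hc]
    by_contra! hlt
    have h0 : 0 < ‖f‖ := by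
      rcases (norm_nonneg f).eq_or_lt with h0 | h0
      · rw [← h0, zero_mul] at hlt
        exact absurd (Finset.sum_nonneg fun j _ => abs_nonneg (q j)) (not_le.2 hlt)
      · exact h0
    have h5 : c * ‖f‖ ^ 2 ≤ c * (f ⬝ᵥ f) := by gcongr
    nlinarith
  obtain ⟨A, b, hAb⟩ := hN'psd.exists_resolvent_eq_sum_inv hP'psd hpd q' (K := K) (by
    refine (hα.and_eventually self_mem_nhdsWithin).mono ?_
    rintro ε ⟨⟨f, hf, hsupp, -⟩, hε⟩
    exact ⟨f, hbound ε hε f hf, hred ε f hf hsupp⟩)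
  -- `f` is the inverse transform of `F`, and `φ` is the primitive of `f`.
  set F : ℝ → J → ℝ := fun ε j => ∑ i, A j i * (1 + b i * ε)⁻¹ with hF
  set f : ℝ → J → ℝ := fun t j => ∑ i, A j i * Real.exp (-b i * t) with hf
  set φ : ℝ → J → ℝ := fun t j => ∑ i, A j i * expPrimitive (b i) t with hφ
  have hFfreq : ∃ᶠ ε in 𝓝[>] (0 : ℝ), IsComplementaritySolution (N + ε • P) q (F ε) ∧
      ∀ j, j ∉ α ↔ F ε j = 0 := by
    refine (hα.and_eventually self_mem_nhdsWithin).mono ?_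
    rintro ε ⟨⟨g, hg, hsupp, -⟩, hε⟩
    have : g = F ε := funext (hAb ε hε g (hred ε g hg hsupp))
    exact this ▸ ⟨hg, hsupp⟩
  have hφan : ∀ j t, AnalyticAt ℝ (fun t => φ t j) t := fun j t =>
    Finset.analyticAt_fun_sum _ fun i _ => analyticAt_const.mul (analyticAt_expPrimitive _ _)
  have hφ0 : ∀ j, φ 0 j = 0 := fun j => by simp [hφ, expPrimitive_zero]
  have hφd : ∀ j t, HasDerivAt (fun t => φ t j) (f t j) t := fun j t =>
    HasDerivAt.fun_sum fun i _ => (hasDerivAt_expPrimitive _ _).const_mul _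
  have hpair : ∀ j, IsBorelLaplacePair (fun ε => F ε j) fun t => f t j := fun j =>
    .sum _ fun i _ => (IsBorelLaplacePair.exp_neg_mul (b i)).const_mul _
  have hpairφ : ∀ j, IsBorelLaplacePair (fun ε => ε * F ε j) fun t => φ t j := fun j =>
    (hpair j).id_mul (hφan j 0) (hφ0 j) (funext fun t => (hφd j t).deriv)
  have hpairg : ∀ j, IsBorelLaplacePair (fun ε => ((N + ε • P) *ᵥ F ε) j - q j)
      fun t => (N *ᵥ f t) j - (q - P *ᵥ φ t) j := by
    intro j
    have h := ((IsBorelLaplacePair.sum Finset.univ fun k _ => (hpair k).const_mul (N j k)).add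
      (IsBorelLaplacePair.sum Finset.univ fun k _ => (hpairφ k).const_mul (P j k))).add
      (.const (-q j))
    convert h using 1
    · funext ε
      rw [add_mulVec, smul_mulVec]
      simp only [mulVec, dotProduct, Pi.add_apply, Pi.smul_apply, smul_eq_mul, Finset.mul_sum,
        ← sub_eq_add_neg]
      congr 2
      exact Finset.sum_congr rfl fun k _ => by ring
    · funext t
      simp only [mulVec, dotProduct, Pi.sub_apply]
      ring
  refine ⟨φ, f, hφan, funext hφ0, hφd, ?_⟩
  have h1 : ∀ᶠ t in 𝓝[>] (0 : ℝ), ∀ j, 0 ≤ f t j := eventually_all.2 fun j =>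
    (hpair j).eventually_nonneg (hFfreq.mono fun ε h => h.1.nonneg j)
  have h2 : ∀ᶠ t in 𝓝[>] (0 : ℝ), ∀ j, 0 ≤ (N *ᵥ f t) j - (q - P *ᵥ φ t) j :=
    eventually_all.2 fun j => (hpairg j).eventually_nonneg
      (hFfreq.mono fun ε h => sub_nonneg.2 (h.1.le_mulVec j))
  have h3 : ∀ᶠ t in 𝓝[>] (0 : ℝ), ∀ j, f t j * ((N *ᵥ f t) j - (q - P *ᵥ φ t) j) = 0 := by
    refine eventually_all.2 fun j => ?_
    by_cases hj : j ∈ α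
    · refine ((hpairg j).eventually_eq_zero (hFfreq.mono fun ε h => ?_)).mono fun t ht => by
        rw [ht, mul_zero]
      exact (mul_eq_zero.1 (h.1.compl j)).resolve_left fun h0 => (h.2 j).2 h0 hj
    · exact ((hpair j).eventually_eq_zero (hFfreq.mono fun ε h => (h.2 j).1 hj)).mono fun t ht =>
        by rw [ht, zero_mul]
  filter_upwards [h1, h2, h3] with t h1 h2 h3
  exact ⟨h1, fun j => sub_nonneg.1 (h2 j), h3⟩

end LinearComplementaritySystem

/-! ### The hypergraph Laplacian and short-time analytic solutions -/

namespace WeightedHypergraph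

theorem single_sub_single_mem_basePolytope {V : Type*} [DecidableEq V] {e : Finset V} {u v : V} (hu : u ∈ e)
    (hv : v ∈ e) :
    (Pi.single u 1 - Pi.single v 1 : V → ℝ) ∈ basePolytope e :=
  subset_convexHull ℝ _ ⟨u, hu, v, hv, rfl⟩

variable {V : Type*} [Fintype V] [DecidableEq V]

theorem single_sub_single_dotProduct (u v : V) (x : V → ℝ) :
    (Pi.single u 1 - Pi.single v 1 : V → ℝ) ⬝ᵥ x = x u - x v := by
  rw [sub_dotProduct, single_one_dotProduct, single_one_dotProduct]

theorem exists_weights_of_mem_basePolytope {e : Finset V} {b : V → ℝ} (hb : b ∈ basePolytope e) :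
    ∃ (ι : Type) (_ : Fintype ι) (c : ι → ℝ) (u v : ι → V), (∀ i, 0 ≤ c i) ∧ ∑ i, c i = 1 ∧
      (∀ i, u i ∈ e) ∧ (∀ i, v i ∈ e) ∧ ∀ x, b ⬝ᵥ x = ∑ i, c i * (x (u i) - x (v i)) := by
  obtain ⟨ι, _, c, z, hc, hc1, hz, rfl⟩ := mem_convexHull_iff_exists_fintype.1 hb
  choose u hu v hv huv using hz
  refine ⟨ι, _, c, u, v, hc, hc1, hu, hv, fun x => ?_⟩
  rw [sum_dotProduct]
  exact Finset.sum_congr rfl fun i _ => by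
    rw [smul_dotProduct, huv, single_sub_single_dotProduct, smul_eq_mul]

theorem dotProduct_le_of_mem_basePolytope {e : Finset V} {b x : V → ℝ} (hb : b ∈ basePolytope e)
    {m : ℝ} (hm : ∀ u ∈ e, ∀ v ∈ e, x u - x v ≤ m) : b ⬝ᵥ x ≤ m := by
  obtain ⟨ι, _, c, u, v, hc, hc1, hu, hv, h⟩ := exists_weights_of_mem_basePolytope hb
  calc b ⬝ᵥ x = ∑ i, c i * (x (u i) - x (v i)) := h x
    _ ≤ ∑ i, c i * m := Finset.sum_le_sum fun i _ =>
      mul_le_mul_of_nonneg_left (hm _ (hu i) _ (hv i)) (hc i)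
    _ = m := by rw [← Finset.sum_mul, hc1, one_mul]

theorem exists_isMaxOn_basePolytope {e : Finset V} (he : e.Nonempty) (x : V → ℝ) :
    ∃ u ∈ e, ∃ v ∈ e, IsMaxOn (fun c => c ⬝ᵥ x) (basePolytope e)
      (Pi.single u 1 - Pi.single v 1) := by
  obtain ⟨u, hu, hmax⟩ := e.exists_max_image x he
  obtain ⟨v, hv, hmin⟩ := e.exists_min_image x he
  refine ⟨u, hu, v, hv, fun c hc => ?_⟩
  simp only [mem_ofPred_eq, single_sub_single_dotProduct]
  exact dotProduct_le_of_mem_basePolytope hc fun a ha b hb => by linarith [hmax a ha, hmin b hb]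

/-- The maximizing vectors of `B_e` transport mass from the minimizers to the maximizers of `x`:
they pair with any vector constant on these two sets as `1_u - 1_v` does. -/
theorem dotProduct_eq_of_isMaxOn {e : Finset V} {b x φ : V → ℝ} (hb : b ∈ basePolytope e)
    (hmax : IsMaxOn (fun c => c ⬝ᵥ x) (basePolytope e) b) {p q : ℝ}
    (hp : ∀ u ∈ argmaxSet x e, φ u = p) (hq : ∀ v ∈ argminSet x e, φ v = q) :
    b ⬝ᵥ φ = p - q := by
  obtain ⟨ι, _, c, u, v, hc, hc1, hu, hv, h⟩ := exists_weights_of_mem_basePolytope hb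
  have hle : ∀ s ∈ e, ∀ t ∈ e, x s - x t ≤ b ⬝ᵥ x := fun s hs t ht => by
    have := hmax (single_sub_single_mem_basePolytope hs ht)
    simpa only [mem_ofPred_eq, single_sub_single_dotProduct] using this
  have hzero : ∀ i ∈ Finset.univ, c i * (b ⬝ᵥ x - (x (u i) - x (v i))) = 0 := by
    refine (Finset.sum_eq_zero_iff_of_nonneg fun i _ =>
      mul_nonneg (hc i) (sub_nonneg.2 (hle _ (hu i) _ (hv i)))).1 ?_
    simp only [mul_sub (c _) (b ⬝ᵥ x)]
    rw [Finset.sum_sub_distrib, ← Finset.sum_mul, hc1, one_mul, ← h, sub_self]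
  rw [h φ]
  calc ∑ i, c i * (φ (u i) - φ (v i)) = ∑ i, c i * (p - q) := by
        refine Finset.sum_congr rfl fun i hi => ?_
        rcases mul_eq_zero.1 (hzero i hi) with h0 | h0
        · rw [h0, zero_mul, zero_mul]
        · rw [hp _ ⟨hu i, fun a ha => by linarith [hle a ha _ (hv i)]⟩,
            hq _ ⟨hv i, fun a ha => by linarith [hle _ (hu i) a ha]⟩]
    _ = p - q := by rw [← Finset.sum_mul, hc1, one_mul]

theorem dotProduct_nonneg_of_isMaxOn {e : Finset V} (he : e.Nonempty) {b x : V → ℝ}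
    (hmax : IsMaxOn (fun c => c ⬝ᵥ x) (basePolytope e) b) : 0 ≤ b ⬝ᵥ x := by
  obtain ⟨u, hu⟩ := he
  have := hmax (single_sub_single_mem_basePolytope hu hu)
  simpa only [mem_ofPred_eq, sub_self, zero_dotProduct] using this

/-- The multivalued Laplacian is a monotone operator. -/
theorem laplacian_monotone (G : WeightedHypergraph V) {x x' y y' : V → ℝ}
    (hy : y ∈ G.laplacian x) (hy' : y' ∈ G.laplacian x') : 0 ≤ (y - y') ⬝ᵥ (x - x') := by
  obtain ⟨b, hb, rfl⟩ := hy
  obtain ⟨b', hb', rfl⟩ := hy'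
  rw [← Finset.sum_sub_distrib, sum_dotProduct]
  refine Finset.sum_nonneg fun e he => ?_
  obtain ⟨hbm, hbmax⟩ := hb e he
  obtain ⟨hbm', hbmax'⟩ := hb' e he
  have h1 : b e ⬝ᵥ x' ≤ b' e ⬝ᵥ x' := hbmax' hbm
  have h2 : b' e ⬝ᵥ x ≤ b e ⬝ᵥ x := hbmax hbm'
  have h3 := dotProduct_nonneg_of_isMaxOn (G.edge_nonempty e he) hbmax
  have h4 := dotProduct_nonneg_of_isMaxOn (G.edge_nonempty e he) hbmax'
  have hw := G.weight_nonneg e he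
  rw [← smul_sub, smul_dotProduct, sub_dotProduct, smul_dotProduct, smul_dotProduct,
    dotProduct_sub, dotProduct_sub]
  simp only [smul_eq_mul]
  refine mul_nonneg hw ?_
  nlinarith [mul_le_mul_of_nonneg_left h1 h3, mul_le_mul_of_nonneg_left h2 h4,
    sq_nonneg (b e ⬝ᵥ x - b' e ⬝ᵥ x')]

/-- A flow along pairs of vertices in a common hyperedge satisfying complementary slackness (the
total flow in `e` is `w(e)` times the oscillation of `x` on `e`, and only uses pairs of a maximizer
and a minimizer) represents an element of the Laplacian. -/
theorem sum_flow_mem_laplacian (G : WeightedHypergraph V) {J : Type*} [Fintype J]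
    {E : J → Finset V} {u v : J → V} (hE : ∀ j, E j ∈ G.edges) (hw : ∀ j, 0 < G.weight (E j))
    (hu : ∀ j, u j ∈ E j) (hv : ∀ j, v j ∈ E j)
    (hall : ∀ e ∈ G.edges, 0 < G.weight e → ∀ a ∈ e, ∀ c ∈ e, ∃ j, E j = e ∧ u j = a ∧ v j = c)
    {f : J → ℝ} (hf : ∀ j, 0 ≤ f j) {x : V → ℝ}
    (hle : ∀ j, x (u j) - x (v j) ≤ (G.weight (E j))⁻¹ * ∑ i with E i = E j, f i)
    (hcompl : ∀ j,
      f j * ((G.weight (E j))⁻¹ * ∑ i with E i = E j, f i - (x (u j) - x (v j))) = 0) :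
    ∑ j, f j • (Pi.single (u j) 1 - Pi.single (v j) 1 : V → ℝ) ∈ G.laplacian x := by
  have key : ∀ e ∈ G.edges, ∃ b ∈ basePolytope e,
      IsMaxOn (fun c => c ⬝ᵥ x) (basePolytope e) b ∧
      G.weight e • (b ⬝ᵥ x) • b =
        ∑ j with E j = e, f j • (Pi.single (u j) 1 - Pi.single (v j) 1 : V → ℝ) := by
    intro e he
    obtain ⟨a, ha, c, hc, hmax⟩ := exists_isMaxOn_basePolytope (G.edge_nonempty e he) x
    rcases (G.weight_nonneg e he).eq_or_lt with hw0 | hw0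
    · refine ⟨_, single_sub_single_mem_basePolytope ha hc, hmax, ?_⟩
      rw [← hw0, zero_smul, Finset.sum_eq_zero]
      intro j hj
      have := hw j
      rw [(Finset.mem_filter.1 hj).2, ← hw0] at this
      exact absurd this (lt_irrefl _)
    set S := ∑ j with E j = e, f j with hS
    have hSle : ∀ a ∈ e, ∀ c ∈ e, x a - x c ≤ (G.weight e)⁻¹ * S := by
      intro a ha c hc
      obtain ⟨j, rfl, rfl, rfl⟩ := hall e he hw0 a ha c hc
      exact hle j
    have hS0 : 0 ≤ S := Finset.sum_nonneg fun j _ => hf j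
    rcases hS0.eq_or_lt with hS0 | hS0
    · refine ⟨_, single_sub_single_mem_basePolytope ha hc, hmax, ?_⟩
      have h0 : (Pi.single a 1 - Pi.single c 1 : V → ℝ) ⬝ᵥ x = 0 := by
        refine le_antisymm ?_ (dotProduct_nonneg_of_isMaxOn (G.edge_nonempty e he) hmax)
        rw [single_sub_single_dotProduct]
        simpa [← hS0] using hSle a ha c hc
      rw [h0, zero_smul, smul_zero, Finset.sum_eq_zero]
      intro j hj
      rw [(Finset.sum_eq_zero_iff_of_nonneg fun j _ => hf j).1 hS0.symm j hj, zero_smul]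
    · set b : V → ℝ :=
        ∑ j with E j = e, (f j / S) • (Pi.single (u j) 1 - Pi.single (v j) 1 : V → ℝ) with hb
      have hbmem : b ∈ basePolytope e := by
        refine (convex_convexHull ℝ _).sum_mem (fun j _ => div_nonneg (hf j) hS0.le) ?_ ?_
        · rw [← Finset.sum_div, ← hS, div_self hS0.ne']
        · intro j hj
          have hj := (Finset.mem_filter.1 hj).2
          exact single_sub_single_mem_basePolytope (hj ▸ hu j) (hj ▸ hv j)
      have hbx : b ⬝ᵥ x = (G.weight e)⁻¹ * S := by
        rw [hb, sum_dotProduct]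
        calc _ = ∑ j with E j = e, f j / S * ((G.weight e)⁻¹ * S) := by
              refine Finset.sum_congr rfl fun j hj => ?_
              have hj := (Finset.mem_filter.1 hj).2
              have h := hcompl j
              rw [hj, ← hS] at h
              rw [smul_dotProduct, single_sub_single_dotProduct, smul_eq_mul]
              rcases mul_eq_zero.1 h with h | h
              · rw [h]; simp
              · rw [sub_eq_zero.1 h]
          _ = _ := by rw [← Finset.sum_mul, ← Finset.sum_div, ← hS, div_self hS0.ne', one_mul]
      refine ⟨b, hbmem, fun c hc => ?_, ?_⟩
      · simp only [mem_ofPred_eq]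
        rw [hbx]
        exact dotProduct_le_of_mem_basePolytope hc hSle
      · rw [hbx, smul_smul, mul_inv_cancel_left₀ hw0.ne', hb, Finset.smul_sum]
        refine Finset.sum_congr rfl fun j _ => ?_
        rw [smul_smul, mul_div_cancel₀ _ hS0.ne']
  choose! b hbmem hbmax hbeq using key
  refine ⟨b, fun e he => ⟨hbmem e he, hbmax e he⟩, ?_⟩
  rw [Finset.sum_congr rfl hbeq]
  exact (Finset.sum_fiberwise_of_maps_to (fun j _ => hE j) _).symm

/-- The heat equation has a real-analytic solution for a short time from any initial vector. -/
theorem exists_analytic_local_solution (G : WeightedHypergraph V) (hdeg : ∀ v, 0 < G.degree v)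
    (x₀ : V → ℝ) : ∃ Y F : ℝ → V → ℝ, (∀ v t, AnalyticAt ℝ (fun t => Y t v) t) ∧ Y 0 = x₀ ∧
      (∀ v t, HasDerivAt (fun t => Y t v) (-F t v / G.degree v) t) ∧
      ∀ᶠ t in 𝓝[>] (0 : ℝ), F t ∈ G.laplacian (Y t) := by
  classical
  -- The unknowns are flows on the pairs of vertices in a common hyperedge of positive weight.
  -- `B` is their divergence and `C` sums them over each hyperedge. The absolute value in `N` only
  -- serves the index sets that are not hyperedges, whose weights are unconstrained.
  let J := {p : Finset V × V × V //
    p.1 ∈ G.edges ∧ 0 < G.weight p.1 ∧ p.2.1 ∈ p.1 ∧ p.2.2 ∈ p.1}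
  let E : J → Finset V := fun j => j.1.1
  let u : J → V := fun j => j.1.2.1
  let v : J → V := fun j => j.1.2.2
  have hw : ∀ j, 0 < G.weight (E j) := fun j => j.2.2.1
  let C : Matrix (Finset V) J ℝ := Matrix.of fun e j => if E j = e then 1 else 0
  let B : Matrix V J ℝ :=
    Matrix.of fun a j => (Pi.single (u j) 1 - Pi.single (v j) 1 : V → ℝ) a
  let N : Matrix J J ℝ := C.conjTranspose * Matrix.diagonal (fun e => |G.weight e|⁻¹) * C
  let P : Matrix J J ℝ := B.conjTranspose * Matrix.diagonal (fun a => (G.degree a)⁻¹) * B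
  have hN : N.PosSemidef := (Matrix.posSemidef_diagonal_iff.2 fun e =>
    inv_nonneg.2 (abs_nonneg _)).conjTranspose_mul_mul_same C
  have hP : P.PosSemidef := (Matrix.posSemidef_diagonal_iff.2 fun a =>
    inv_nonneg.2 (hdeg a).le).conjTranspose_mul_mul_same B
  have hNv : ∀ f j, (N.mulVec f) j = (G.weight (E j))⁻¹ * ∑ i with E i = E j, f i := by
    intro f j
    have hC : ∀ e, (C.mulVec f) e = ∑ i with E i = e, f i := fun e => by
      simp [C, Matrix.mulVec, dotProduct, Finset.sum_filter]
    simp only [N, ← Matrix.mulVec_mulVec]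
    have : ∀ z : Finset V → ℝ, (C.conjTranspose.mulVec z) j = z (E j) := fun z => by
      simp [C, Matrix.mulVec, dotProduct]
    rw [this, Matrix.mulVec_diagonal, hC, abs_of_pos (hw j)]
  have hBv : ∀ f, B.mulVec f = ∑ j, f j • (Pi.single (u j) 1 - Pi.single (v j) 1 : V → ℝ) := by
    intro f
    funext a
    simp only [B, Matrix.mulVec, dotProduct, Matrix.of_apply, Finset.sum_apply, Pi.smul_apply,
      smul_eq_mul]
    exact Finset.sum_congr rfl fun j _ => mul_comm _ _
  have hPv : ∀ f j, (P.mulVec f) j =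
      (B.mulVec f) (u j) / G.degree (u j) - (B.mulVec f) (v j) / G.degree (v j) := by
    intro f j
    simp only [P, ← Matrix.mulVec_mulVec]
    have : ∀ z : V → ℝ, (B.conjTranspose.mulVec z) j = z (u j) - z (v j) := fun z => by
      rw [← single_sub_single_dotProduct]
      simp [B, Matrix.mulVec, dotProduct]
    rw [this, Matrix.mulVec_diagonal, Matrix.mulVec_diagonal]
    ring
  -- A lower bound of all `w(e)⁻¹`, hence a coercivity constant of `N` on the orthant.
  set c : ℝ := (1 + ∑ e ∈ G.edges, G.weight e)⁻¹ with hcdef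
  have hsum0 : 0 ≤ ∑ e ∈ G.edges, G.weight e := Finset.sum_nonneg G.weight_nonneg
  have hc : 0 < c := inv_pos.2 (by linarith)
  have hcle : ∀ j, c ≤ (G.weight (E j))⁻¹ := fun j => by
    refine inv_anti₀ (hw j) ?_
    have := Finset.single_le_sum G.weight_nonneg j.2.1
    linarith
  obtain ⟨φ, f, han, hφ0, hder, hsol⟩ := exists_analytic_complementarity_system hN hP hc (by
    intro f hf
    simp only [dotProduct, hNv, Finset.mul_sum]
    refine Finset.sum_le_sum fun j _ => ?_
    rw [← Finset.mul_sum, ← Finset.mul_sum]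
    have h1 : f j ≤ ∑ i with E i = E j, f i :=
      Finset.single_le_sum (fun i _ => hf i) (by simp)
    calc c * (f j * f j) = f j * (c * f j) := by ring
      _ ≤ f j * ((G.weight (E j))⁻¹ * ∑ i with E i = E j, f i) := by
        have := hf j
        have := hcle j
        have := inv_pos.2 (hw j)
        gcongr) (fun j => x₀ (u j) - x₀ (v j))
  refine ⟨fun t a => x₀ a - (B.mulVec (φ t)) a / G.degree a, fun t => B.mulVec (f t),
    fun a t => ?_, ?_, fun a t => ?_, ?_⟩
  · refine analyticAt_const.sub (AnalyticAt.div_const ?_)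
    exact Finset.analyticAt_fun_sum _ fun j _ => analyticAt_const.mul (han j t)
  · funext a
    simp [hφ0]
  · have h : HasDerivAt (fun t => (B.mulVec (φ t)) a) ((B.mulVec (f t)) a) t :=
      HasDerivAt.fun_sum fun j _ => (hder j t).const_mul _
    refine ((h.div_const (G.degree a)).const_sub (x₀ a)).congr_deriv ?_
    ring
  · filter_upwards [hsol] with t ht
    rw [hBv (f t)]
    refine G.sum_flow_mem_laplacian (fun j => j.2.1) hw (fun j => j.2.2.2.1)
      (fun j => j.2.2.2.2) ?_ ht.nonneg (fun j => ?_) fun j => ?_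
    · exact fun e he hwe a ha c hc => ⟨⟨(e, a, c), he, hwe, ha, hc⟩, rfl, rfl, rfl⟩
    · have := ht.le_mulVec j
      simp only [hNv, Pi.sub_apply, hPv] at this
      linarith
    · have := ht.compl j
      simp only [hNv, Pi.sub_apply, hPv] at this
      refine Eq.trans ?_ this
      ring

end WeightedHypergraph

/-! ### Right derivatives and the order of the vertices along a solution -/

theorem rightDeriv_iterate_eqOn {f Y : ℝ → ℝ} (hY : ∀ t, AnalyticAt ℝ Y t) {a b : ℝ}
    (h : EqOn f Y (Ico a b)) (k : ℕ) : EqOn (rightDeriv^[k] f) (iteratedDeriv k Y) (Ico a b) := by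
  induction k with
  | zero => simpa using h
  | succ k ih =>
    intro t ht
    rw [Function.iterate_succ_apply', iteratedDeriv_succ, rightDeriv]
    have hev : rightDeriv^[k] f =ᶠ[𝓝[≥] t] iteratedDeriv k Y := by
      filter_upwards [Ico_mem_nhdsGE ht.2] with x hx
      exact ih ⟨ht.1.trans hx.1, hx.2⟩
    rw [hev.derivWithin_eq (ih ht)]
    have hd : DifferentiableAt ℝ (iteratedDeriv k Y) t :=
      ((hY t).iterated_deriv k |>.congr (by rw [iteratedDeriv_eq_iterate])).differentiableAt
    exact hd.derivWithin (uniqueDiffOn_Ici t t self_mem_Ici)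

theorem differentiableWithinAt_rightDeriv_iterate {f Y : ℝ → ℝ} (hY : ∀ t, AnalyticAt ℝ Y t)
    {a b : ℝ} (h : EqOn f Y (Ico a b)) (k : ℕ) {t : ℝ} (ht : t ∈ Ico a b) :
    DifferentiableWithinAt ℝ (rightDeriv^[k] f) (Ici t) t := by
  have hev : rightDeriv^[k] f =ᶠ[𝓝[≥] t] iteratedDeriv k Y := by
    filter_upwards [Ico_mem_nhdsGE ht.2] with x hx
    exact rightDeriv_iterate_eqOn hY h k ⟨ht.1.trans hx.1, hx.2⟩
  have hd : DifferentiableAt ℝ (iteratedDeriv k Y) t :=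
    ((hY t).iterated_deriv k |>.congr (by rw [iteratedDeriv_eq_iterate])).differentiableAt
  exact hd.differentiableWithinAt.congr_of_eventuallyEq hev
    (rightDeriv_iterate_eqOn hY h k ht)

section OrderedEquivalence

variable {V : Type*} {κ : V → ℕ → ℝ}

theorem lexAboveEq_total (u v : V) : LexAboveEq κ u v ∨ LexAbove κ v u := by
  classical
  by_cases h : ∀ k, κ u k = κ v k
  · exact .inl (.inl (funext h))
  push Not at h
  have hlt : ∀ k < Nat.find h, κ u k = κ v k := fun k hk => by
    simpa using Nat.find_min h hk
  rcases lt_or_gt_of_ne (Nat.find_spec h) with hn | hn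
  · exact .inr ⟨_, fun k hk => (hlt k hk).symm, hn⟩
  · exact .inl (.inr ⟨_, hlt, hn⟩)

theorem LexAboveEq.trans {u v w : V} (h : LexAboveEq κ u v) (h' : LexAboveEq κ v w) :
    LexAboveEq κ u w := by
  rcases h with h | ⟨l, hl, hlt⟩
  · rcases h' with h' | ⟨m, hm, hmt⟩
    · exact .inl (h.trans h')
    · exact .inr ⟨m, fun k hk => by rw [h, hm k hk], by rw [h]; exact hmt⟩
  rcases h' with h' | ⟨m, hm, hmt⟩
  · exact .inr ⟨l, fun k hk => by rw [← h', hl k hk], by rw [← h']; exact hlt⟩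
  rcases lt_trichotomy l m with hlm | rfl | hlm
  · exact .inr ⟨l, fun k hk => by rw [hl k hk, hm k (hk.trans hlm)], by rw [← hm l hlm]; exact hlt⟩
  · exact .inr ⟨l, fun k hk => by rw [hl k hk, hm k hk], hmt.trans hlt⟩
  · exact .inr ⟨m, fun k hk => by rw [hl k (hk.trans hlm), hm k hk], by rw [hl m hlm]; exact hmt⟩

theorem exists_lexAboveEq_forall {s : Finset V} (hs : s.Nonempty) :
    ∃ u ∈ s, ∀ v ∈ s, LexAboveEq κ u v := by
  classical
  induction hs using Finset.Nonempty.cons_induction with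
  | singleton a => exact ⟨a, by simp, fun v hv => .inl (by rw [Finset.mem_singleton.1 hv])⟩
  | cons a s ha hs ih =>
    obtain ⟨u, hu, h⟩ := ih
    rcases lexAboveEq_total (κ := κ) u a with hua | hau
    · refine ⟨u, by simp [hu], fun v hv => ?_⟩
      rcases Finset.mem_cons.1 hv with rfl | hv
      · exact hua
      · exact h v hv
    · refine ⟨a, by simp, fun v hv => ?_⟩
      rcases Finset.mem_cons.1 hv with rfl | hv
      · exact .inl rfl
      · exact LexAboveEq.trans (.inr hau) (h v hv)

theorem exists_forall_lexAboveEq {s : Finset V} (hs : s.Nonempty) :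
    ∃ u ∈ s, ∀ v ∈ s, LexAboveEq κ v u := by
  classical
  induction hs using Finset.Nonempty.cons_induction with
  | singleton a => exact ⟨a, by simp, fun v hv => .inl (by rw [Finset.mem_singleton.1 hv])⟩
  | cons a s ha hs ih =>
    obtain ⟨u, hu, h⟩ := ih
    rcases lexAboveEq_total (κ := κ) a u with hau | hua
    · refine ⟨u, by simp [hu], fun v hv => ?_⟩
      rcases Finset.mem_cons.1 hv with rfl | hv
      · exact hau
      · exact h v hv
    · refine ⟨a, by simp, fun v hv => ?_⟩
      rcases Finset.mem_cons.1 hv with rfl | hv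
      · exact .inl rfl
      · exact (h v hv).trans (.inr hua)

theorem topSet_nonempty {e : Finset V} (he : e.Nonempty) : (topSet κ e).Nonempty := by
  classical
  obtain ⟨u, hu, hmax⟩ := e.exists_max_image (fun v => κ v 0) he
  obtain ⟨w, hw, h⟩ := exists_lexAboveEq_forall (κ := κ)
    (s := e.filter fun a => ∀ v ∈ e, κ v 0 ≤ κ a 0) ⟨u, by simpa [hu] using hmax⟩
  exact ⟨w, by simpa [argmaxSet] using hw, fun v hv => h v (by simpa [argmaxSet] using hv)⟩

theorem bottomSet_nonempty {e : Finset V} (he : e.Nonempty) : (bottomSet κ e).Nonempty := by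
  classical
  obtain ⟨u, hu, hmin⟩ := e.exists_min_image (fun v => κ v 0) he
  obtain ⟨w, hw, h⟩ := exists_forall_lexAboveEq (κ := κ)
    (s := e.filter fun a => ∀ v ∈ e, κ a 0 ≤ κ v 0) ⟨u, by simpa [hu] using hmin⟩
  exact ⟨w, by simpa [argminSet] using hw, fun v hv => h v (by simpa [argminSet] using hv)⟩

theorem eq_of_mem_topSet {e : Finset V} {u v : V} (hu : u ∈ topSet κ e) (hv : v ∈ topSet κ e) :
    κ u = κ v :=
  LexAboveEq.antisymm (hu.2 v hv.1) (hv.2 u hu.1)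

theorem eq_of_mem_bottomSet {e : Finset V} {u v : V} (hu : u ∈ bottomSet κ e)
    (hv : v ∈ bottomSet κ e) : κ u = κ v :=
  LexAboveEq.antisymm (hv.2 u hu.1) (hu.2 v hv.1)

/-- If vertices with equal values have equal derivatives of all orders, the top set of an edge
is the set of its maximizers. -/
theorem topSet_eq_argmaxSet (h : ∀ u v, κ u 0 = κ v 0 → κ u = κ v) (e : Finset V) :
    topSet κ e = argmaxSet (fun v => κ v 0) e :=
  Subset.antisymm (fun _ hu => hu.1) fun u hu =>
    ⟨hu, fun v hv => .inl (h u v (le_antisymm (hv.2 u hu.1) (hu.2 v hv.1)))⟩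

theorem bottomSet_eq_argminSet (h : ∀ u v, κ u 0 = κ v 0 → κ u = κ v) (e : Finset V) :
    bottomSet κ e = argminSet (fun v => κ v 0) e :=
  Subset.antisymm (fun _ hu => hu.1) fun u hu =>
    ⟨hu, fun v hv => .inl (h v u (le_antisymm (hv.2 u hu.1) (hu.2 v hv.1)))⟩

theorem le_of_lexAboveEq {u v : V} (h : LexAboveEq κ u v) : κ v 0 ≤ κ u 0 := by
  rcases h with h | ⟨l, hl, hlt⟩
  · rw [h]
  · rcases Nat.eq_zero_or_pos l with rfl | hl0
    · exact hlt.le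
    · exact (hl 0 hl0).ge

theorem mem_topSet_iff {e : Finset V} {u : V} :
    u ∈ topSet κ e ↔ u ∈ e ∧ ∀ v ∈ e, LexAboveEq κ u v := by
  refine ⟨fun h => ⟨h.1.1, fun v hv => ?_⟩, fun h =>
    ⟨⟨h.1, fun v hv => le_of_lexAboveEq (h.2 v hv)⟩, fun v hv => h.2 v hv.1⟩⟩
  rcases (h.1.2 v hv).eq_or_lt with h0 | h0
  · exact h.2 v ⟨hv, fun w hw => by rw [h0]; exact h.1.2 w hw⟩
  · exact .inr ⟨0, by simp, h0⟩

theorem mem_bottomSet_iff {e : Finset V} {u : V} :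
    u ∈ bottomSet κ e ↔ u ∈ e ∧ ∀ v ∈ e, LexAboveEq κ v u := by
  refine ⟨fun h => ⟨h.1.1, fun v hv => ?_⟩, fun h =>
    ⟨⟨h.1, fun v hv => le_of_lexAboveEq (h.2 v hv)⟩, fun v hv => h.2 v hv.1⟩⟩
  rcases (h.1.2 v hv).eq_or_lt with h0 | h0
  · exact h.2 v ⟨hv, fun w hw => by rw [← h0]; exact h.1.2 w hw⟩
  · exact .inr ⟨0, by simp, h0⟩

end OrderedEquivalence

/-- Analytic functions are compared to the right of a point by the lexicographic order of their
sequences of derivatives. -/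
theorem AnalyticAt.eventually_lexAboveEq_iff {V : Type*} {Y : ℝ → V → ℝ} {a : ℝ}
    (hY : ∀ v t, AnalyticAt ℝ (fun t => Y t v) t) (u v : V) :
    ∀ᶠ t in 𝓝[>] a, (LexAboveEq (fun v k => iteratedDeriv k (fun t => Y t v) t) u v ↔
      LexAboveEq (fun v k => iteratedDeriv k (fun t => Y t v) a) u v) ∧
      (Y t u = Y t v → (fun k => iteratedDeriv k (fun t => Y t u) t) =
        fun k => iteratedDeriv k (fun t => Y t v) t) := by
  have hsub : ∀ k t, iteratedDeriv k (fun t => Y t u - Y t v) t =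
      iteratedDeriv k (fun t => Y t u) t - iteratedDeriv k (fun t => Y t v) t := fun k t =>
    iteratedDeriv_fun_sub (hY u t).contDiffAt (hY v t).contDiffAt
  rcases ((hY u a).sub (hY v a)).eventually_sign_trichotomy with
    ⟨h0, hev⟩ | ⟨⟨n, hlt, hn⟩, hev⟩ | ⟨⟨n, hlt, hn⟩, hev⟩
  · have hev' := hev.eventually_nhds.filter_mono (nhdsWithin_le_nhds (s := Ioi a))
    filter_upwards [hev'] with t ht
    have heq : (fun k => iteratedDeriv k (fun t => Y t u) t) =
        fun k => iteratedDeriv k (fun t => Y t v) t := by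
      funext k
      have : (fun t => Y t u) =ᶠ[𝓝 t] fun t => Y t v := ht.mono fun x hx => sub_eq_zero.1 hx
      exact this.iteratedDeriv_eq k
    refine ⟨⟨fun _ => .inl (funext fun k => ?_), fun _ => .inl heq⟩, fun _ => heq⟩
    exact sub_eq_zero.1 ((hsub k a).symm.trans (h0 k))
  · filter_upwards [hev] with t ht
    have ht : 0 < Y t u - Y t v := ht
    refine ⟨iff_of_true (.inr ⟨0, by simp, ?_⟩) (.inr ⟨n, fun k hk => ?_, ?_⟩), fun h => ?_⟩
    · simpa using ht
    · exact sub_eq_zero.1 ((hsub k a).symm.trans (hlt k hk))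
    · exact sub_pos.1 ((hn.trans_eq (hsub n a)))
    · linarith
  · filter_upwards [hev] with t ht
    have ht : Y t u - Y t v < 0 := ht
    refine ⟨iff_of_false (fun h => ?_) (fun h => ?_), fun h => by linarith⟩
    · have := le_of_lexAboveEq h
      simp only [iteratedDeriv_zero] at this
      linarith
    · have hvu : LexAboveEq (fun v k => iteratedDeriv k (fun t => Y t v) a) v u :=
        .inr ⟨n, fun k hk => (sub_eq_zero.1 ((hsub k a).symm.trans (hlt k hk))).symm,
          sub_neg.1 ((hsub n a).symm.trans_lt hn)⟩
      have := congrFun (h.antisymm hvu) n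
      have h2 := hsub n a
      rw [this, sub_self] at h2
      exact hn.ne h2

namespace WeightedHypergraph

set_option linter.unusedSectionVars false

variable {V : Type*} [Fintype V] [DecidableEq V]

section HeatSolution

variable {G : WeightedHypergraph V} {s : V → ℝ} {ρ : ℝ → V → ℝ}

theorem absolutelyContinuous_potential
    (hρ : IsHeatSolution G.normalizedLaplacian s (Ici 0) ρ) {a b : ℝ} (ha : 0 ≤ a) (hb : 0 ≤ b)
    (v : V) : AbsolutelyContinuousOnInterval (fun t => G.potential (ρ t) v) a b := by
  have h := ((hρ.1 a ha b hb).apply v).const_mul (G.degree v)⁻¹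
  convert h using 2 with t
  rw [potential]
  ring

theorem ae_hasDerivAt_potential (hρ : IsHeatSolution G.normalizedLaplacian s (Ici 0) ρ) :
    ∀ᵐ t, t ∈ Ici (0 : ℝ) → ∃ y ∈ G.laplacian (G.potential (ρ t)), ∀ v,
      HasDerivAt (fun t => G.potential (ρ t) v) (-y v / G.degree v) t := by
  have h := (ae_restrict_iff' measurableSet_Ici).1 hρ.2.2
  filter_upwards [h] with t ht h0
  obtain ⟨y, hy, hd⟩ := ht h0
  exact ⟨y, hy, fun v => (hasDerivAt_pi.1 hd v).div_const _⟩

/-- At every time, a solution of the heat equation continues to the right as the restriction of a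
function that is real-analytic on the whole line. -/
theorem exists_analytic_right_continuation (hdeg : ∀ v, 0 < G.degree v)
    (hρ : IsHeatSolution G.normalizedLaplacian s (Ici 0) ρ) {a : ℝ} (ha : 0 ≤ a) :
    ∃ b > a, ∃ Y : ℝ → V → ℝ, (∀ v t, AnalyticAt ℝ (fun t => Y t v) t) ∧
      EqOn (fun t => G.potential (ρ t)) Y (Ico a b) := by
  obtain ⟨Y, F, han, hY0, hd, hF⟩ := G.exists_analytic_local_solution hdeg (G.potential (ρ a))
  obtain ⟨δ, hδ, hsub⟩ := mem_nhdsGT_iff_exists_Ioo_subset.1 hF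
  have hδ : 0 < δ := hδ
  have han' : ∀ v t, AnalyticAt ℝ (fun t => Y (t - a) v) t := fun v t =>
    AnalyticAt.fun_comp (g := fun t => Y t v) (f := fun t => t - a) (han v (t - a)) (by fun_prop)
  refine ⟨a + δ, by linarith, fun t => Y (t - a), han', fun t ht => ?_⟩
  have hz := AbsolutelyContinuousOnInterval.eq_zero_of_energy_nonincreasing hdeg
    (z := fun t => G.potential (ρ t) - Y (t - a)) ht.1 (fun v => ?_) (by simp [hY0]) ?_
  · exact sub_eq_zero.1 hz
  · have hc : ContDiffOn ℝ 1 (fun t => Y (t - a) v) (uIcc a t) := fun x _ =>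
      (han' v x).contDiffAt.contDiffWithinAt
    exact (absolutelyContinuous_potential hρ ha (ha.trans ht.1) v).fun_sub
      hc.absolutelyContinuousOnInterval
  · filter_upwards [ae_hasDerivAt_potential hρ] with x hx hxI
    obtain ⟨y, hy, hyd⟩ := hx (ha.trans hxI.1.le)
    refine ⟨fun v => -y v / G.degree v - -F (x - a) v / G.degree v, fun v => ?_, ?_⟩
    · have h2 : HasDerivAt (fun t => Y (t - a) v) (-F (x - a) v / G.degree v) x :=
        (hd v (x - a)).comp_sub_const x a
      exact (hyd v).sub h2
    · have hmono := G.laplacian_monotone hy (hsub ⟨by linarith [hxI.1], by linarith [hxI.2, ht.2]⟩ :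
        F (x - a) ∈ G.laplacian (Y (x - a)))
      calc _ = -((y - F (x - a)) ⬝ᵥ (G.potential (ρ x) - Y (x - a))) := by
            rw [dotProduct, ← Finset.sum_neg_distrib]
            refine Finset.sum_congr rfl fun v _ => ?_
            have := (hdeg v).ne'
            simp only [Pi.sub_apply]
            field_simp
            ring
        _ ≤ 0 := by linarith

theorem derivSeq_eq {Y : ℝ → V → ℝ} (hY : ∀ v t, AnalyticAt ℝ (fun t => Y t v) t) {a b : ℝ}
    (h : EqOn (fun t => G.potential (ρ t)) Y (Ico a b)) {t : ℝ} (ht : t ∈ Ico a b) :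
    G.derivSeq ρ t = fun v k => iteratedDeriv k (fun t => Y t v) t := by
  funext v k
  exact rightDeriv_iterate_eqOn (hY v) (fun x hx => congrFun (h hx) v) k ht

/-- Just after any time, the lexicographic order of the vertices is the one at that time, and
vertices with equal values are equivalent. -/
theorem eventually_lexAboveEq_derivSeq_iff (hdeg : ∀ v, 0 < G.degree v)
    (hρ : IsHeatSolution G.normalizedLaplacian s (Ici 0) ρ) {a : ℝ} (ha : 0 ≤ a) :
    ∀ᶠ t in 𝓝[>] a, ∀ u v,
      (LexAboveEq (G.derivSeq ρ t) u v ↔ LexAboveEq (G.derivSeq ρ a) u v) ∧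
      (G.potential (ρ t) u = G.potential (ρ t) v → G.derivSeq ρ t u = G.derivSeq ρ t v) := by
  obtain ⟨b, hb, Y, hY, hEq⟩ := exists_analytic_right_continuation hdeg hρ ha
  have hev := eventually_all.2 fun u => eventually_all.2 fun v =>
    AnalyticAt.eventually_lexAboveEq_iff (a := a) hY u v
  filter_upwards [hev, Ioo_mem_nhdsGT hb] with t ht htI u v
  have htI' : t ∈ Ico a b := ⟨htI.1.le, htI.2⟩
  rw [derivSeq_eq hY hEq htI', derivSeq_eq hY hEq ⟨le_rfl, hb⟩]
  have h1 := hEq htI'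
  simp only at h1
  rw [h1]
  exact ht u v

theorem exists_noTieBefore (hdeg : ∀ v, 0 < G.degree v)
    (hρ : IsHeatSolution G.normalizedLaplacian s (Ici 0) ρ) : ∃ T, 0 < T ∧ G.NoTieBefore ρ T := by
  obtain ⟨T, hT, hsub⟩ := mem_nhdsGT_iff_exists_Ioo_subset.1
    (eventually_lexAboveEq_derivSeq_iff hdeg hρ le_rfl)
  refine ⟨T, hT, fun t ht e _ => ?_⟩
  rcases ht.1.eq_or_lt with rfl | h0
  · exact ⟨rfl, rfl⟩
  have h := hsub ⟨h0, ht.2⟩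
  constructor
  · ext u
    simp only [mem_topSet_iff, (h _ _).1]
  · ext u
    simp only [mem_bottomSet_iff, (h _ _).1]

/-- At almost every time, vertices with equal values are equivalent: the exceptional times are
isolated from the right among the times at which the two values coincide. -/
theorem ae_derivSeq_eq_of_potential_eq (hdeg : ∀ v, 0 < G.degree v)
    (hρ : IsHeatSolution G.normalizedLaplacian s (Ici 0) ρ) :
    ∀ᵐ t, t ∈ Ici (0 : ℝ) → ∀ u v,
      G.potential (ρ t) u = G.potential (ρ t) v → G.derivSeq ρ t u = G.derivSeq ρ t v := by
  have hall : ∀ u v, ∀ᵐ t, t ∈ Ici (0 : ℝ) →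
      G.potential (ρ t) u = G.potential (ρ t) v → G.derivSeq ρ t u = G.derivSeq ρ t v := by
    intro u v
    set A := {t : ℝ | G.potential (ρ t) u = G.potential (ρ t) v}
    have hcount := (countable_setOfPred_isolated_right_within (s := A)).ae_notMem volume
    filter_upwards [hcount] with t ht ht0 htA
    by_contra hne
    refine ht ⟨htA, ?_⟩
    rw [← empty_mem_iff_bot, inter_comm, nhdsWithin_inter', mem_inf_principal]
    obtain ⟨b, hb, Y, hY, hEq⟩ := exists_analytic_right_continuation hdeg hρ ht0
    have hval : ∀ x ∈ Ico t b, G.potential (ρ x) = Y x := fun x hx => hEq hx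
    rw [derivSeq_eq hY hEq ⟨le_rfl, hb⟩] at hne
    have hsub : ∀ k, iteratedDeriv k (fun t => Y t u - Y t v) t =
        iteratedDeriv k (fun t => Y t u) t - iteratedDeriv k (fun t => Y t v) t := fun k =>
      iteratedDeriv_fun_sub (hY u t).contDiffAt (hY v t).contDiffAt
    have hnz : ∀ᶠ x in 𝓝[>] t, Y x u - Y x v ≠ 0 := by
      rcases ((hY u t).sub (hY v t)).eventually_sign_trichotomy with ⟨h0, -⟩ | ⟨-, h⟩ | ⟨-, h⟩
      · exact absurd (funext fun k => sub_eq_zero.1 ((hsub k).symm.trans (h0 k))) hne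
      · exact h.mono fun x hx => hx.ne'
      · exact h.mono fun x hx => hx.ne
    filter_upwards [hnz, Ioo_mem_nhdsGT hb] with x hx hxI hxA
    have hxA : G.potential (ρ x) u = G.potential (ρ x) v := hxA
    rw [hval x ⟨hxI.1.le, hxI.2⟩] at hxA
    exact hx (sub_eq_zero.2 hxA)
  filter_upwards [ae_all_iff.2 fun u => ae_all_iff.2 fun v => hall u v] with t ht h0 u v
  exact ht u v h0

end HeatSolution

end WeightedHypergraph

/-! ### The contracted graph and the linear equation before the next tie -/

namespace WeightedGraph

set_option linter.unusedSectionVars false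

variable {W : Type*} [Fintype W] [DecidableEq W]

theorem normalizedLaplacian_mulVec_degree_mul (H : WeightedGraph W) (hdeg : ∀ a, 0 < H.degree a)
    (x : W → ℝ) (a : W) : H.normalizedLaplacian.mulVec (fun a => H.degree a * x a) a =
      ∑ b, H.weight a b * (x a - x b) := by
  rw [normalizedLaplacian, Matrix.sub_mulVec, Matrix.one_mulVec, Pi.sub_apply]
  simp only [Matrix.mulVec, dotProduct, Matrix.mul_diagonal, Matrix.of_apply, mul_sub]
  rw [Finset.sum_sub_distrib, ← Finset.sum_mul]
  congr 1
  refine Finset.sum_congr rfl fun b _ => ?_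
  have := (hdeg b).ne'
  field_simp

theorem dirichlet_nonneg (H : WeightedGraph W) (x : W → ℝ) :
    0 ≤ ∑ a, x a * ∑ b, H.weight a b * (x a - x b) := by
  have h1 : ∑ a, x a * ∑ b, H.weight a b * (x a - x b) =
      ∑ a, ∑ b, H.weight a b * (x a * (x a - x b)) := by
    refine Finset.sum_congr rfl fun a _ => ?_
    rw [Finset.mul_sum]
    exact Finset.sum_congr rfl fun b _ => by ring
  have h2 : ∑ a, ∑ b, H.weight a b * (x a * (x a - x b)) =
      ∑ a, ∑ b, H.weight a b * (x b * (x b - x a)) := by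
    rw [Finset.sum_comm]
    exact Finset.sum_congr rfl fun a _ => Finset.sum_congr rfl fun b _ => by
      rw [H.weight_symm]
  have h3 : 0 ≤ ∑ a, ∑ b, H.weight a b * (x a * (x a - x b)) +
      ∑ a, ∑ b, H.weight a b * (x b * (x b - x a)) := by
    rw [← Finset.sum_add_distrib]
    refine Finset.sum_nonneg fun a _ => ?_
    rw [← Finset.sum_add_distrib]
    refine Finset.sum_nonneg fun b _ => ?_
    have := mul_nonneg (H.weight_nonneg a b) (sq_nonneg (x a - x b))
    linarith
  linarith

/-- Solutions of the heat equation of a graph are determined by their initial value. -/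
theorem heatSolution_unique (H : WeightedGraph W) (hdeg : ∀ a, 0 < H.degree a) {s : W → ℝ} {T : ℝ}
    {y z : ℝ → W → ℝ}
    (hy : IsHeatSolution (fun x => {H.normalizedLaplacian.mulVec x}) s (Ico 0 T) y)
    (hz : IsHeatSolution (fun x => {H.normalizedLaplacian.mulVec x}) s (Ico 0 T) z) :
    EqOn y z (Ico 0 T) := by
  intro t ht
  have h0 : (0 : ℝ) ∈ Ico 0 T := ⟨le_rfl, ht.1.trans_lt ht.2⟩
  have key := AbsolutelyContinuousOnInterval.eq_zero_of_energy_nonincreasing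
    (m := fun a => (H.degree a)⁻¹) (fun a => inv_pos.2 (hdeg a)) (z := fun t => y t - z t) ht.1
    (fun a => ((hy.1 0 h0 t ht).apply a).fun_sub ((hz.1 0 h0 t ht).apply a))
    (by simp [hy.2.1, hz.2.1]) ?_
  · exact sub_eq_zero.1 key
  · filter_upwards [(ae_restrict_iff' measurableSet_Ico).1 hy.2.2,
      (ae_restrict_iff' measurableSet_Ico).1 hz.2.2] with r hr hr' hrI
    have hrI' : r ∈ Ico 0 T := ⟨hrI.1.le, hrI.2.trans ht.2⟩
    obtain ⟨_, rfl, hd⟩ := hr hrI'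
    obtain ⟨_, rfl, hd'⟩ := hr' hrI'
    refine ⟨_, fun a => hasDerivAt_pi.1 (hd.sub hd') a, ?_⟩
    set x : W → ℝ := fun a => (H.degree a)⁻¹ * (y r a - z r a) with hx
    have hyz : y r - z r = fun a => H.degree a * x a := by
      funext a
      rw [hx, mul_inv_cancel_left₀ (hdeg a).ne', Pi.sub_apply]
    have h1 : ∀ a, (-H.normalizedLaplacian.mulVec (y r) - -H.normalizedLaplacian.mulVec (z r)) a =
        -∑ b, H.weight a b * (x a - x b) := by
      intro a
      rw [← H.normalizedLaplacian_mulVec_degree_mul hdeg, ← hyz, Matrix.mulVec_sub]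
      simp only [Pi.sub_apply, Pi.neg_apply]
      ring
    simp only [h1, Pi.sub_apply]
    have := H.dirichlet_nonneg x
    simp only [mul_neg, Finset.sum_neg_distrib]
    exact neg_nonpos.2 this

end WeightedGraph

section DerivClass

variable {V : Type*} {κ : V → ℕ → ℝ}

theorem DerivClass.of_eq_of_iff {u v : V} : DerivClass.of κ u = DerivClass.of κ v ↔ κ u = κ v :=
  Quotient.eq.trans Iff.rfl

theorem DerivClass.exists_of_eq (U : DerivClass κ) : ∃ v, DerivClass.of κ v = U :=
  Quotient.exists_rep U

theorem meets_topSet_iff {e : Finset V} {a : V} (ha : a ∈ topSet κ e) {U : DerivClass κ} :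
    Meets κ (topSet κ e) U ↔ DerivClass.of κ a = U := by
  refine ⟨fun h => Meets.topSet_unique ⟨a, ha, rfl⟩ h, fun h => ⟨a, ha, h⟩⟩

theorem meets_bottomSet_iff {e : Finset V} {a : V} (ha : a ∈ bottomSet κ e) {U : DerivClass κ} :
    Meets κ (bottomSet κ e) U ↔ DerivClass.of κ a = U := by
  refine ⟨fun h => Meets.bottomSet_unique ⟨a, ha, rfl⟩ h, fun h => ⟨a, ha, h⟩⟩

end DerivClass

namespace WeightedHypergraph

set_option linter.unusedSectionVars false

variable {V : Type*} [Fintype V] [DecidableEq V]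

/-- The bilinear form `∑ₑ w(e) (φ(aₑ) - φ(cₑ)) (x(aₑ) - x(cₑ))` of the graph that joins, for each
hyperedge `e`, a chosen vertex `aₑ` of its top set to a chosen vertex `cₑ` of its bottom set. -/
def dirichletForm (G : WeightedHypergraph V) (a c : G.edges → V) (φ x : V → ℝ) : ℝ :=
  ∑ e : G.edges, G.weight e * ((φ (a e) - φ (c e)) * (x (a e) - x (c e)))

/-- Vectors that are constant on the top set and on the bottom set of each hyperedge: those on which
`dirichletForm` does not depend on the chosen vertices. -/
def IsAdapted (G : WeightedHypergraph V) (κ : V → ℕ → ℝ) (φ : V → ℝ) : Prop :=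
  ∀ e ∈ G.edges, (∀ u ∈ topSet κ e, ∀ v ∈ topSet κ e, φ u = φ v) ∧
    ∀ u ∈ bottomSet κ e, ∀ v ∈ bottomSet κ e, φ u = φ v

theorem IsAdapted.sub {G : WeightedHypergraph V} {κ : V → ℕ → ℝ} {φ ψ : V → ℝ}
    (h : G.IsAdapted κ φ) (h' : G.IsAdapted κ ψ) : G.IsAdapted κ (φ - ψ) := fun e he =>
  ⟨fun u hu v hv => by
    rw [Pi.sub_apply, Pi.sub_apply, (h e he).1 u hu v hv, (h' e he).1 u hu v hv],
   fun u hu v hv => by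
    rw [Pi.sub_apply, Pi.sub_apply, (h e he).2 u hu v hv, (h' e he).2 u hu v hv]⟩

theorem isAdapted_of_class (G : WeightedHypergraph V) {κ : V → ℕ → ℝ} {φ : V → ℝ}
    (h : ∀ u v, κ u = κ v → φ u = φ v) : G.IsAdapted κ φ := fun _ _ =>
  ⟨fun u hu v hv => h u v (eq_of_mem_topSet hu hv),
    fun u hu v hv => h u v (eq_of_mem_bottomSet hu hv)⟩

section Contraction

variable (G : WeightedHypergraph V) {κ : V → ℕ → ℝ}

theorem contractedGraph_degree (U : DerivClass κ) :
    (G.contractedGraph κ).degree U = aggregate κ G.degree U := by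
  have h : ∀ U', (G.contractedGraph κ).weight U U' = G.contractedWeight κ U U' := fun _ => rfl
  simp only [WeightedGraph.degree, h]
  rw [← Finset.add_sum_erase _ _ (Finset.mem_univ U)]
  have h1 : ∑ U' ∈ Finset.univ.erase U, G.contractedWeight κ U U' =
      ∑ U' with U' ≠ U, (G.flowWeight κ U U' + G.flowWeight κ U' U) := by
    refine Finset.sum_congr (by ext; simp) fun U' hU' => ?_
    rw [contractedWeight, if_neg (Finset.mem_filter.1 hU').2.symm]
  rw [h1, contractedWeight, if_pos rfl, sub_add_cancel]

theorem contractedGraph_degree_pos (hdeg : ∀ v, 0 < G.degree v) (U : DerivClass κ) :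
    0 < (G.contractedGraph κ).degree U := by
  classical
  rw [contractedGraph_degree]
  obtain ⟨v, hv⟩ := U.exists_of_eq
  exact Finset.sum_pos (fun v _ => hdeg v) ⟨v, by simp [hv]⟩

/-- On vectors constant on the classes, the form tested against the indicator of a class is the
Laplacian of the contracted graph. -/
theorem dirichletForm_indicator {a c : G.edges → V} (ha : ∀ e : G.edges, a e ∈ topSet κ e)
    (hc : ∀ e : G.edges, c e ∈ bottomSet κ e) (X : DerivClass κ → ℝ) (U : DerivClass κ) :
    G.dirichletForm a c (fun v => if DerivClass.of κ v = U then 1 else 0)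
      (fun v => X (DerivClass.of κ v)) =
    ∑ U', (G.contractedGraph κ).weight U U' * (X U - X U') := by
  classical
  have hflow : ∀ U₁ U₂, G.flowWeight κ U₁ U₂ = ∑ e : G.edges,
      if DerivClass.of κ (a e) = U₁ ∧ DerivClass.of κ (c e) = U₂ then G.weight e else 0 := by
    intro U₁ U₂
    rw [flowWeight, Finset.sum_filter, ← Finset.sum_coe_sort]
    refine Finset.sum_congr rfl fun e _ => ?_
    simp only [meets_topSet_iff (ha e), meets_bottomSet_iff (hc e)]
  have hterm : ∀ U', (G.contractedGraph κ).weight U U' * (X U - X U') =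
      ∑ e : G.edges, G.weight e *
        ((if U' = DerivClass.of κ (c e) then
          if DerivClass.of κ (a e) = U then X U - X U' else 0 else 0) +
         (if U' = DerivClass.of κ (a e) then
          if DerivClass.of κ (c e) = U then X U - X U' else 0 else 0)) := by
    intro U'
    by_cases hU : U = U'
    · subst hU
      simp
    · have : (G.contractedGraph κ).weight U U' = G.flowWeight κ U U' + G.flowWeight κ U' U :=
        if_neg hU
      rw [this, hflow, hflow, ← Finset.sum_add_distrib, Finset.sum_mul]
      refine Finset.sum_congr rfl fun e _ => ?_
      simp only [eq_comm (a := U')]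
      simp only [ite_and]
      split_ifs <;> ring
  simp only [hterm]
  rw [Finset.sum_comm]
  refine Finset.sum_congr rfl fun e _ => ?_
  rw [← Finset.mul_sum, Finset.sum_add_distrib, Finset.sum_ite_eq', Finset.sum_ite_eq']
  simp only [Finset.mem_univ, if_true]
  congr 1
  by_cases h1 : DerivClass.of κ (a e) = U <;> by_cases h2 : DerivClass.of κ (c e) = U <;>
    simp [h1, h2]

end Contraction

section NoTie

variable {G : WeightedHypergraph V} {s : V → ℝ} {ρ : ℝ → V → ℝ} {T : ℝ}

theorem NoTieBefore.isAdapted_potential (hT : G.NoTieBefore ρ T) {t : ℝ} (ht : t ∈ Ico 0 T) :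
    G.IsAdapted (G.derivSeq ρ 0) (G.potential (ρ t)) := by
  intro e he
  obtain ⟨h1, h2⟩ := hT t ht e he
  rw [← h1, ← h2]
  exact ⟨fun u hu v hv => congrFun (eq_of_mem_topSet hu hv) 0,
    fun u hu v hv => congrFun (eq_of_mem_bottomSet hu hv) 0⟩

theorem laplacian_dotProduct_eq_dirichletForm {κ : V → ℕ → ℝ} {a c : G.edges → V}
    (ha : ∀ e : G.edges, a e ∈ topSet κ e) (hc : ∀ e : G.edges, c e ∈ bottomSet κ e)
    {x y φ : V → ℝ} (hmax : ∀ e ∈ G.edges, topSet κ e = argmaxSet x e)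
    (hmin : ∀ e ∈ G.edges, bottomSet κ e = argminSet x e) (hy : y ∈ G.laplacian x)
    (hx : G.IsAdapted κ x) (hφ : G.IsAdapted κ φ) : y ⬝ᵥ φ = G.dirichletForm a c φ x := by
  obtain ⟨b, hb, rfl⟩ := hy
  rw [sum_dotProduct, dirichletForm, ← Finset.sum_coe_sort]
  refine Finset.sum_congr rfl fun e _ => ?_
  have hpair : ∀ ψ, G.IsAdapted κ ψ → b e ⬝ᵥ ψ = ψ (a e) - ψ (c e) := fun ψ hψ =>
    dotProduct_eq_of_isMaxOn (hb e e.2).1 (hb e e.2).2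
      (fun u hu => (hψ e e.2).1 u (hmax e e.2 ▸ hu) _ (ha e))
      fun v hv => (hψ e e.2).2 v (hmin e e.2 ▸ hv) _ (hc e)
  rw [smul_dotProduct, smul_dotProduct, hpair φ hφ, hpair x hx, smul_eq_mul, smul_eq_mul]
  ring

/-- Before the next tie, the heat equation tested against an adapted vector is linear. -/
theorem NoTieBefore.ae_weak_equation (hdeg : ∀ v, 0 < G.degree v)
    (hρ : IsHeatSolution G.normalizedLaplacian s (Ici 0) ρ) (hT : G.NoTieBefore ρ T)
    {a c : G.edges → V} (ha : ∀ e : G.edges, a e ∈ topSet (G.derivSeq ρ 0) e)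
    (hc : ∀ e : G.edges, c e ∈ bottomSet (G.derivSeq ρ 0) e) :
    ∀ᵐ t, t ∈ Ico 0 T → ∃ y : V → ℝ,
      (∀ v, HasDerivAt (fun t => G.potential (ρ t) v) (-y v / G.degree v) t) ∧
      ∀ φ, G.IsAdapted (G.derivSeq ρ 0) φ → y ⬝ᵥ φ = G.dirichletForm a c φ (G.potential (ρ t)) := by
  filter_upwards [ae_hasDerivAt_potential hρ, ae_derivSeq_eq_of_potential_eq hdeg hρ]
    with t h1 h2 ht
  obtain ⟨y, hy, hd⟩ := h1 ht.1
  refine ⟨y, hd, fun φ hφ => laplacian_dotProduct_eq_dirichletForm ha hc (fun e he => ?_)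
    (fun e he => ?_) hy (hT.isAdapted_potential ht) hφ⟩
  · rw [← (hT t ht e he).1]
    exact topSet_eq_argmaxSet (h2 ht.1) e
  · rw [← (hT t ht e he).2]
    exact bottomSet_eq_argminSet (h2 ht.1) e

/-- Before the next tie, the solution is the restriction of a function that is real-analytic on the
line, constant on the classes at time `0`, and solves the linear equation tested against all
adapted vectors. -/
theorem NoTieBefore.exists_analytic_extension (hdeg : ∀ v, 0 < G.degree v)
    (hρ : IsHeatSolution G.normalizedLaplacian s (Ici 0) ρ) (hT0 : 0 < T)
    (hT : G.NoTieBefore ρ T)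
    {a c : G.edges → V} (ha : ∀ e : G.edges, a e ∈ topSet (G.derivSeq ρ 0) e)
    (hc : ∀ e : G.edges, c e ∈ bottomSet (G.derivSeq ρ 0) e) :
    ∃ Y : ℝ → V → ℝ, (∀ v t, AnalyticAt ℝ (fun t => Y t v) t) ∧
      EqOn (fun t => G.potential (ρ t)) Y (Ico 0 T) ∧
      (∀ t u v, G.derivSeq ρ 0 u = G.derivSeq ρ 0 v → Y t u = Y t v) ∧
      ∀ φ, G.IsAdapted (G.derivSeq ρ 0) φ → ∀ t,
        ∑ v, G.degree v * φ v * deriv (fun t => Y t v) t = -G.dirichletForm a c φ (Y t) := by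
  obtain ⟨b, hb, Y, hY, hEq⟩ := exists_analytic_right_continuation hdeg hρ le_rfl
  have hweak := hT.ae_weak_equation hdeg hρ ha hc
  have hclass : ∀ t u v, G.derivSeq ρ 0 u = G.derivSeq ρ 0 v → Y t u = Y t v := by
    intro t u v huv
    rw [derivSeq_eq hY hEq ⟨le_rfl, hb⟩] at huv
    have h0 := ((hY u 0).sub (hY v 0)).eventually_eq_zero_of_iteratedDeriv_eq_zero fun k => by
      refine (iteratedDeriv_fun_sub (hY u 0).contDiffAt (hY v 0).contDiffAt).trans ?_
      exact sub_eq_zero.2 (congrFun huv k)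
    have := AnalyticOnNhd.eq_of_eventuallyEq (f := fun t => Y t u) (g := fun t => Y t v) (z₀ := 0)
      (fun t _ => hY u t) (fun t _ => hY v t) (h0.mono fun x hx => sub_eq_zero.1 hx)
    exact congrFun this t
  have hlin : ∀ φ, G.IsAdapted (G.derivSeq ρ 0) φ → ∀ t,
      ∑ v, G.degree v * φ v * deriv (fun t => Y t v) t = -G.dirichletForm a c φ (Y t) := by
    intro φ hφ
    -- Both sides are analytic and agree at almost every small positive time.
    refine congrFun (AnalyticOnNhd.eq_of_frequently_eq (z₀ := 0) (fun t _ => ?_) (fun t _ => ?_)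
      ?_)
    · exact Finset.analyticAt_fun_sum _ fun v _ => analyticAt_const.mul (hY v t).deriv
    · exact AnalyticAt.neg (Finset.analyticAt_fun_sum _ fun e _ => analyticAt_const.mul
        (analyticAt_const.mul ((hY _ t).sub (hY _ t))))
    · refine Frequently.filter_mono (f := 𝓝[>] 0) ?_ (nhdsWithin_mono _ fun x hx => ne_of_gt hx)
      rw [Filter.Frequently]
      intro hev
      obtain ⟨r, hr, hsub⟩ := mem_nhdsGT_iff_exists_Ioo_subset.1 hev
      have hr : 0 < r := hr
      obtain ⟨t, ht, htI⟩ := (Measure.dense_of_ae hweak).exists_between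
        (lt_min hr (lt_min hb hT0))
      have ht1 : t < r := htI.2.trans_le (min_le_left _ _)
      have ht2 : t < b := htI.2.trans_le ((min_le_right _ _).trans (min_le_left _ _))
      have ht3 : t < T := htI.2.trans_le ((min_le_right _ _).trans (min_le_right _ _))
      refine hsub ⟨htI.1, ht1⟩ ?_
      obtain ⟨y, hd, hy⟩ := ht ⟨htI.1.le, ht3⟩
      have hder : ∀ v, deriv (fun t => Y t v) t = -y v / G.degree v := fun v => by
        refine ((hd v).congr_of_eventuallyEq ?_).deriv
        filter_upwards [Ioo_mem_nhds htI.1 ht2] with x hx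
        exact (congrFun (hEq ⟨hx.1.le, hx.2⟩) v).symm
      have hYt : Y t = G.potential (ρ t) := (hEq ⟨htI.1.le, ht2⟩).symm
      simp only [hder]
      rw [hYt, ← hy φ hφ, dotProduct, ← Finset.sum_neg_distrib]
      refine Finset.sum_congr rfl fun v _ => ?_
      have := (hdeg v).ne'
      field_simp
  refine ⟨Y, hY, fun t ht => ?_, hclass, hlin⟩
  -- The difference is adapted, so that the linear equation can be tested against it.
  have key := AbsolutelyContinuousOnInterval.eq_zero_of_energy_nonincreasing hdeg
    (z := fun t => G.potential (ρ t) - Y t) ht.1 (fun v => ?_)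
    (sub_eq_zero.2 (hEq ⟨le_rfl, hb⟩)) ?_
  · exact sub_eq_zero.1 key
  · have hcd : ContDiffOn ℝ 1 (fun t => Y t v) (uIcc 0 t) := fun x _ =>
      (hY v x).contDiffAt.contDiffWithinAt
    exact (absolutelyContinuous_potential hρ le_rfl ht.1 v).fun_sub
      hcd.absolutelyContinuousOnInterval
  · filter_upwards [hweak] with r hr hrI
    have hrT : r ∈ Ico 0 T := ⟨hrI.1.le, hrI.2.trans ht.2⟩
    obtain ⟨y, hd, hy⟩ := hr hrT
    refine ⟨fun v => -y v / G.degree v - deriv (fun t => Y t v) r, fun v =>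
      (hd v).sub (hY v r).differentiableAt.hasDerivAt, ?_⟩
    have hz : G.IsAdapted (G.derivSeq ρ 0) (G.potential (ρ r) - Y r) :=
      (hT.isAdapted_potential hrT).sub (G.isAdapted_of_class (hclass r))
    set z := G.potential (ρ r) - Y r with hzdef
    have h1 := hlin z hz r
    have h2 := hy z hz
    have h3 : ∑ v, G.degree v * z v * (-y v / G.degree v - deriv (fun t => Y t v) r) =
        -(y ⬝ᵥ z) - ∑ v, G.degree v * z v * deriv (fun t => Y t v) r := by
      rw [dotProduct, ← Finset.sum_neg_distrib, ← Finset.sum_sub_distrib]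
      refine Finset.sum_congr rfl fun v _ => ?_
      have := (hdeg v).ne'
      field_simp
    rw [h3, h1, h2, dirichletForm, dirichletForm, ← Finset.sum_neg_distrib, sub_neg_eq_add,
      ← Finset.sum_add_distrib]
    refine Finset.sum_nonpos fun e _ => ?_
    have := mul_nonneg (G.weight_nonneg e e.2) (mul_self_nonneg (z (a e) - z (c e)))
    have hze : ∀ v, G.potential (ρ r) v = z v + Y r v := fun v => by simp [hzdef]
    rw [hze, hze]
    linarith

end NoTie

end WeightedHypergraph

/-! ### The heat equation until the next tie -/

theorem mainTheorem5 {V : Type*} [Fintype V] [DecidableEq V] (G : WeightedHypergraph V)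
    (hdeg : ∀ v, 0 < G.degree v) (s : V → ℝ) (ρ : ℝ → V → ℝ)
    (hρ : IsHeatSolution G.normalizedLaplacian s (Set.Ici 0) ρ) :
    -- all right derivatives of `ρ / d_G` exist at all times
    (∀ t, 0 ≤ t → ∀ (v : V) (k : ℕ),
      DifferentiableWithinAt ℝ (rightDeriv^[k] (fun τ => G.potential (ρ τ) v)) (Set.Ici t) t) ∧
    -- the next tie occurs at a positive time, if at all
    (∃ T, 0 < T ∧ G.NoTieBefore ρ T) ∧
    -- until the next tie, the aggregated vector is the unique solution of the graph heat equation
    -- and determines `ρ`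
    ∀ T, 0 < T → G.NoTieBefore ρ T →
      let κ := G.derivSeq ρ 0
      let H := G.contractedGraph κ
      let ρ' : ℝ → DerivClass κ → ℝ := fun t => aggregate κ (ρ t)
      let A : (DerivClass κ → ℝ) → Set (DerivClass κ → ℝ) :=
        fun y => {H.normalizedLaplacian.mulVec y}
      IsHeatSolution A (aggregate κ s) (Set.Ico 0 T) ρ' ∧
      (∀ t ∈ Set.Ico 0 T,
        HasDerivWithinAt ρ' (-(H.normalizedLaplacian.mulVec (ρ' t))) (Set.Ico 0 T) t) ∧
      (∀ y, IsHeatSolution A (aggregate κ s) (Set.Ico 0 T) y → Set.EqOn y ρ' (Set.Ico 0 T)) ∧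
      (∀ t ∈ Set.Ico 0 T, ∀ u,
        ρ t u = G.degree u * (ρ' t (DerivClass.of κ u) / H.degree (DerivClass.of κ u))) := by
  classical
  refine ⟨fun t ht v k => ?_, G.exists_noTieBefore hdeg hρ, fun T hT0 hT => ?_⟩
  · obtain ⟨b, hb, Y, hY, hEq⟩ := WeightedHypergraph.exists_analytic_right_continuation hdeg hρ ht
    exact differentiableWithinAt_rightDeriv_iterate (hY v) (fun x hx => congrFun (hEq hx) v) k
      ⟨le_rfl, hb⟩
  intro κ H ρ' A
  choose a ha using fun e : G.edges => topSet_nonempty (κ := κ) (G.edge_nonempty e e.2)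
  choose c hc using fun e : G.edges => bottomSet_nonempty (κ := κ) (G.edge_nonempty e e.2)
  obtain ⟨Y, hY, hEq, hclass, hlin⟩ := hT.exists_analytic_extension hdeg hρ hT0 ha hc
  have hH : ∀ U, 0 < H.degree U := G.contractedGraph_degree_pos hdeg
  let X : ℝ → DerivClass κ → ℝ := fun t U => Y t U.out
  have hXY : ∀ t v, Y t v = X t (DerivClass.of κ v) := fun t v =>
    hclass t _ _ (DerivClass.of_eq_of_iff.1 (Quotient.out_eq (DerivClass.of κ v)).symm)
  have hρY : ∀ t ∈ Ico 0 T, ∀ v, ρ t v = G.degree v * Y t v := fun t ht v => by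
    have h : G.potential (ρ t) v = Y t v := congrFun (hEq ht) v
    rw [← h, WeightedHypergraph.potential, mul_div_cancel₀ _ (hdeg v).ne']
  have hagg : ∀ t U, ∑ v, G.degree v * (if DerivClass.of κ v = U then 1 else 0) * Y t v =
      H.degree U * X t U := by
    intro t U
    rw [G.contractedGraph_degree, aggregate, Finset.sum_mul, Finset.sum_filter]
    refine Finset.sum_congr rfl fun v _ => ?_
    split_ifs with h
    · rw [hXY, h, mul_one]
    · rw [mul_zero, zero_mul]
  have hρ'X : ∀ t ∈ Ico 0 T, ρ' t = fun U => H.degree U * X t U := by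
    intro t ht
    funext U
    rw [← hagg, ← Finset.sum_congr rfl fun v _ => mul_right_comm _ _ _]
    simp only [ρ', aggregate, Finset.sum_filter, mul_ite, mul_one, mul_zero, ← hρY t ht]
  have hderX : ∀ t, HasDerivAt (fun t U => H.degree U * X t U)
      (-(H.normalizedLaplacian.mulVec fun U => H.degree U * X t U)) t := by
    intro t
    refine hasDerivAt_pi.2 fun U => ?_
    have h1 : HasDerivAt
        (fun t => ∑ v, G.degree v * (if DerivClass.of κ v = U then 1 else 0) * Y t v)
        (∑ v, G.degree v * (if DerivClass.of κ v = U then 1 else 0) *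
          deriv (fun t => Y t v) t) t :=
      HasDerivAt.fun_sum fun v _ => (hY v t).differentiableAt.hasDerivAt.const_mul _
    simp only [hagg] at h1
    have hφ : G.IsAdapted κ fun v => if DerivClass.of κ v = U then 1 else 0 :=
      G.isAdapted_of_class fun u v huv => by rw [DerivClass.of_eq_of_iff.2 huv]
    rw [hlin _ hφ t, funext (hXY t), G.dirichletForm_indicator ha hc] at h1
    rwa [Pi.neg_apply, H.normalizedLaplacian_mulVec_degree_mul hH]
  have hder : ∀ t ∈ Ico 0 T,
      HasDerivWithinAt ρ' (-(H.normalizedLaplacian.mulVec (ρ' t))) (Ico 0 T) t := by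
    intro t ht
    rw [hρ'X t ht]
    exact (hderX t).hasDerivWithinAt.congr hρ'X (hρ'X t ht)
  have hsol : IsHeatSolution A (aggregate κ s) (Ico 0 T) ρ' := by
    refine ⟨fun x hx y hy => ?_, congrArg (aggregate κ) hρ.2.1, ?_⟩
    · let L : (V → ℝ) →ₗ[ℝ] (DerivClass κ → ℝ) :=
        { toFun := aggregate κ
          map_add' := fun x y => by funext U; simp [aggregate, Finset.sum_add_distrib]
          map_smul' := fun r x => by funext U; simp [aggregate, Finset.mul_sum] }
      exact (LinearMap.toContinuousLinearMap L).lipschitz.comp_absolutelyContinuousOnInterval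
        (hρ.1 x hx.1 y hy.1)
    · rw [ae_restrict_iff' measurableSet_Ico]
      filter_upwards [(countable_singleton (0 : ℝ)).ae_notMem volume] with t ht0 ht
      have ht0 : 0 < t := lt_of_le_of_ne ht.1 fun h => ht0 h.symm
      exact ⟨_, rfl, (hder t ht).hasDerivAt (Ico_mem_nhds ht0 ht.2)⟩
  refine ⟨hsol, hder, fun y hy => H.heatSolution_unique hH hy hsol, fun t ht u => ?_⟩
  have h : ρ' t (DerivClass.of κ u) =
      H.degree (DerivClass.of κ u) * X t (DerivClass.of κ u) := congrFun (hρ'X t ht) _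
  rw [h, mul_div_cancel_left₀ _ (hH _).ne', ← hXY, hρY t ht]
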